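/- Theorem 3. Let $0<H<1$, $\sigma>0$, $0\le q<p$, and let $\alpha_0,\dots,\alpha_p$, $\beta_1,\dots,\beta_q$ be real with $\alpha_1\ne 0$ and (if $q\geq 1$) $\beta_q\neq 0$. Let $A$ be the $p\times p$ companion matrix with ones on the superdiagonal, last row $(\alpha_1,\dots,\alpha_p)$ and zeros elsewhere; let $\delta_p=(0,\dots,0,1)'$, $\beta=(1,\beta_1,\dots,\beta_{p-1})'$ with $\beta_j=0$ for $j>q$, $\alpha(z)=z^p-\alpha_pz^{p-1}-\dots-\alpha_1$ and $\beta(z)=1+\beta_1z+\dots+\beta_qz^q$. Assume that all eigenvalues of $A$ have negative real parts. Let $\{B^H_t\}_{t\in\mathbb R}$ be a standard fractional Brownian motion, that is, a centred Gaussian process with $B_0^H=0$ and $E(B^H_tB^H_s)=\frac12\{|t|^{2H}+|s|^{2H}-|t-s|^{2H}\}$ for $s,t\in\mathbb R$. Say that a square-integrable real process $\{Y_t\}_{t\in\mathbb R}$ with constant mean has spectral density $f$ if $f\ge0$ is integrable on $\mathbb R$ and $\operatorname{cov}(Y_{t+h},Y_t)=\int_{-\infty}^{\infty}e^{ihw}f(w)\,dw$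 for all $t,h\in\mathbb R$. Put $$f_Y(w)=\frac{\sigma^2}{2\pi}\Gamma(2H+1)\sin(\pi H)|w|^{1-2H}\frac{|\beta(iw)|^2}{|\alpha(iw)|^2}.$$ (a) For every $t\in\mathbb R$ the integral in $$Y_t=-\frac{\alpha_0}{\alpha_1}+\sigma\int_{-\infty}^t\beta' e^{A(t-u)}\delta_p\,dB_u^H$$ exists (as the $L^2$ limit, when $a\to-\infty$, of the integrals over $[a,t]$, each of which is the $L^2$ limit of Riemann sums over tagged partitions with mesh tending to zero), and this stationary CARFIMA$(p,H,q)$ process $\{Y_t\}_{t\in\mathbb R}$ has spectral density $f_Y$. (b) More generally, if $\{X_t\}_{t\in\mathbb R}$ is any strictly stationary process in $\mathbb R^p$ with almost surely continuous paths that solves $dX_t=(AX_t+\alpha_0\delta_p)\,dt+\sigma\delta_p\,dB^H_t$ on $\mathbb R$, that is, almost surely $X_t-X_s=\int_s^t(AX_u+\alpha_0\delta_p)\,du+\sigma\delta_p(B^H_t-B^H_s)$ for all $s\le t$, then $Y_t=\beta'X_t$ has spectral density $f_Y$. (c) For every $w$ (for $w\neq0$ when $H>1/2$), $f_Y(w)$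 is the product of the ARMA spectral density $\frac{\sigma^2}{2\pi}\frac{|\beta(iw)|^2}{|\alpha(iw)|^2}$ and the fractional-noise factor $\Gamma(2H+1)\sin(\pi H)|w|^{1-2H}$; in particular $f_Y(0)=0$ when $H<1/2$. -/

import Mathlib

open MeasureTheory ProbabilityTheory Filter Topology Matrix

noncomputable section

namespace Carfima

variable {Ω : Type*} [MeasurableSpace Ω]

/-- Standard two-sided fractional Brownian motion with Hurst parameter `H`: a Gaussian process
started at `0`, centred, with covariance kernel `(|t|^{2H} + |s|^{2H} - |t - s|^{2H}) / 2`. -/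
structure IsFBM (P : Measure Ω) (H : ℝ) (B : ℝ → Ω → ℝ) : Prop where
  gaussian : IsGaussianProcess B P
  zero : ∀ᵐ ω ∂P, B 0 ω = 0
  mean : ∀ t, ∫ ω, B t ω ∂P = 0
  kernel : ∀ s t, ∫ ω, B t ω * B s ω ∂P
    = (|t| ^ (2 * H) + |s| ^ (2 * H) - |t - s| ^ (2 * H)) / 2

/-- `J` is the stochastic integral `∫_a^b f(u) dB_u` of the deterministic function `f`, `a ≤ b`:
the limit in `L²(P)` of the Riemann sums over tagged partitions `a = u 0 ≤ ⋯ ≤ u n = b` with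
tags `τ k ∈ [u k, u (k + 1)]`, as the mesh tends to zero. -/
def IsIntegral (P : Measure Ω) (B : ℝ → Ω → ℝ) (f : ℝ → ℝ) (a b : ℝ) (J : Ω → ℝ) : Prop :=
  MemLp J 2 P ∧ ∀ ε : ℝ, 0 < ε → ∃ δ : ℝ, 0 < δ ∧
    ∀ (n : ℕ) (u τ : ℕ → ℝ), u 0 = a → u n = b →
      (∀ k < n, u k ≤ τ k ∧ τ k ≤ u (k + 1) ∧ u (k + 1) - u k ≤ δ) →
      eLpNorm (fun ω => (∑ k ∈ Finset.range n, f (τ k) * (B (u (k + 1)) ω - B (u k) ω)) - J ω) 2 P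
        ≤ ENNReal.ofReal ε

/-- `J` is the stochastic integral `∫_{-∞}^t f(u) dB_u`: the limit in `L²(P)` of
`∫_a^t f(u) dB_u` as `a → -∞`. -/
def IsIntegralIic (P : Measure Ω) (B : ℝ → Ω → ℝ) (f : ℝ → ℝ) (t : ℝ) (J : Ω → ℝ) : Prop :=
  MemLp J 2 P ∧ ∃ K : ℝ → Ω → ℝ, (∀ a < t, IsIntegral P B f a t (K a)) ∧
    Tendsto (fun a => eLpNorm (fun ω => K a ω - J ω) 2 P) atBot (𝓝 0)

/-- The `p × p` companion matrix: ones on the superdiagonal, last row `α 1, …, α p`. -/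
def companion (p : ℕ) (α : ℕ → ℝ) : Matrix (Fin p) (Fin p) ℝ := fun i j =>
  if (i : ℕ) + 1 = p then α (j + 1) else if (j : ℕ) = i + 1 then 1 else 0

/-- The last standard basis vector `(0, …, 0, 1)'` of `ℝ^p`. -/
def deltaVec (p : ℕ) : Fin p → ℝ := fun i => if (i : ℕ) + 1 = p then 1 else 0

/-- The vector `(1, β 1, …, β q, 0, …, 0)'` of `ℝ^p`. -/
def betaVec (p q : ℕ) (β : ℕ → ℝ) : Fin p → ℝ := fun i =>
  if (i : ℕ) = 0 then 1 else if (i : ℕ) ≤ q then β i else 0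

/-- `α(z) = z^p - α_p z^{p-1} - ⋯ - α_1`. -/
def alphaPoly (p : ℕ) (α : ℕ → ℝ) (z : ℂ) : ℂ :=
  z ^ p - ∑ j ∈ Finset.Icc 1 p, (α j : ℂ) * z ^ (j - 1)

/-- `β(z) = 1 + β_1 z + ⋯ + β_q z^q`. -/
def betaPoly (q : ℕ) (β : ℕ → ℝ) (z : ℂ) : ℂ :=
  1 + ∑ j ∈ Finset.Icc 1 q, (β j : ℂ) * z ^ j

/-- All complex eigenvalues of the real matrix `A` have negative real parts. -/
def IsStable {p : ℕ} (A : Matrix (Fin p) (Fin p) ℝ) : Prop :=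
  ∀ z : ℂ, Module.End.HasEigenvalue (Matrix.toLin' (A.map (fun x : ℝ => (x : ℂ)))) z → z.re < 0

/-- Strict stationarity: the finite-dimensional distributions are invariant under time shifts. -/
def IsStrictlyStationary {E : Type*} [MeasurableSpace E] (P : Measure Ω) (X : ℝ → Ω → E) : Prop :=
  ∀ (I : Finset ℝ) (h : ℝ),
    IdentDistrib (fun ω (t : I) => X (t + h) ω) (fun ω (t : I) => X t ω) P P

/-- `X` solves the state equation `dX_t = (A X_t + α_0 δ_p) dt + σ δ_p dB_t` on the whole real
line, read as an integral equation: almost every path is continuous and satisfies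
`X_t - X_s = ∫_s^t (A X_u + α_0 δ_p) du + σ (B_t - B_s) δ_p` for all `s ≤ t`. -/
def IsStateSolution (P : Measure Ω) (B : ℝ → Ω → ℝ) (p : ℕ) (α : ℕ → ℝ) (σ : ℝ)
    (X : ℝ → Ω → Fin p → ℝ) : Prop :=
  ∀ᵐ ω ∂P, Continuous (fun t => X t ω) ∧ ∀ s t : ℝ, s ≤ t →
    X t ω - X s ω = (∫ u in s..t, (companion p α *ᵥ X u ω + α 0 • deltaVec p))
      + (σ * (B t ω - B s ω)) • deltaVec p

/-- `Y` is the moving-average process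
`Y_t = -α_0 / α_1 + σ ∫_{-∞}^t β' exp(A (t - u)) δ_p dB_u`, `t ∈ ℝ`. -/
def IsMovingAverage (P : Measure Ω) (B : ℝ → Ω → ℝ) (p q : ℕ) (α β : ℕ → ℝ) (σ : ℝ)
    (Y : ℝ → Ω → ℝ) : Prop :=
  ∀ t : ℝ, ∃ J : Ω → ℝ,
    IsIntegralIic P B
      (fun u => betaVec p q β ⬝ᵥ (NormedSpace.exp ((t - u) • companion p α) *ᵥ deltaVec p)) t J ∧
    ∀ᵐ ω ∂P, Y t ω = -(α 0 / α 1) + σ * J ω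

/-- The real process `Y` is covariance-stationary with spectral density `f`: `f` is nonnegative
and integrable, and `cov(Y_{t+h}, Y_t) = ∫ e^{ihw} f(w) dw` for all real `t`, `h`. -/
structure HasSpectralDensity (P : Measure Ω) (Y : ℝ → Ω → ℝ) (f : ℝ → ℝ) : Prop where
  memLp : ∀ t, MemLp (Y t) 2 P
  mean_eq : ∀ s t, ∫ ω, Y s ω ∂P = ∫ ω, Y t ω ∂P
  nonneg : ∀ w, 0 ≤ f w
  integrable : Integrable f
  cov_eq : ∀ t h : ℝ, ((cov[Y (t + h), Y t; P] : ℝ) : ℂ)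
    = ∫ w : ℝ, Complex.exp (Complex.I * (h : ℂ) * (w : ℂ)) * (f w : ℂ)

/-- The spectral density of the continuous-time ARMA process (the case of Brownian noise). -/
def armaDensity (p q : ℕ) (α β : ℕ → ℝ) (σ w : ℝ) : ℝ :=
  σ ^ 2 / (2 * Real.pi) *
    (‖betaPoly q β (Complex.I * (w : ℂ))‖ ^ 2 / ‖alphaPoly p α (Complex.I * (w : ℂ))‖ ^ 2)

/-- The CARFIMA spectral density. -/
def carfimaDensity (p q : ℕ) (α β : ℕ → ℝ) (H σ w : ℝ) : ℝ :=
  σ ^ 2 / (2 * Real.pi) * Real.Gamma (2 * H + 1) * Real.sin (Real.pi * H) * |w| ^ (1 - 2 * H) *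
    (‖betaPoly q β (Complex.I * (w : ℂ))‖ ^ 2 / ‖alphaPoly p α (Complex.I * (w : ℂ))‖ ^ 2)

end Carfima

end

/-! In the Hilbert space L²(P), fractional Brownian motion is a curve `b` with ‖b x - b y‖ = |x -
y|^H, and only this second-order structure matters for the spectral density. Integrating 1 - cos(tw)
against |w|^(-1-2H) gives a multiple of |t|^(2H) (`integral_one_sub_cos_mul_abs_rpow`); by
polarization, inner products of increments of `b` are integrals of products of differences of
characters against |w|^(-1-2H) (`covariance_increments_eq_integral`).

The integrand is g(t - u) with g(r) = β' exp(Ar) δ_p smooth, so Riemann sums converge to an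
integration-by-parts expression (`exists_mesh_norm_riemannSum_sub_byParts_le`), with no case
distinction on H. Since g decays exponentially for stable A, the limit a → -∞ is the Bochner
integral of g'(r) (b(t - r) - b(t)) over r > 0, called `incrementAverage`. Two uses of Fubini give
it the spectral density |K(w)|² |w|^(-1-2H), up to the constant `specConst`, where K(w) is the
integral of g'(r) (exp(-irw) - 1) (`IsFractionalCurve.inner_incrementAverage`). Integration by parts
turns K(w) into iw times the Fourier transform of g (`incrementTransfer_kernel`), and that transform
is β(iw)/α(iw) (`integral_expI_mul_kernel`). The factor |iw|² raises the exponent from -1-2H to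
1-2H.

For a stationary solution, variation of constants on [t - n, t] writes β'X_t as an initial term plus
a pathwise integral, which agrees with the mean-square one. By stationarity and stability the
initial term vanishes in probability, so β'X_t is almost surely the moving average
(`IsStateSolution.isMovingAverage`). -/

namespace Carfima

/-! ### The integral of (1 - cos x) x^(-1-2H). -/

section OneSubCos

open Set Real

/-- A nonzero value of the Bochner integral already forces integrability, because the default value
is 0. -/
theorem lintegral_ofReal_of_integral_eq {f : ℝ → ℝ} {V : ℝ} (hV : 0 < V)
    (hf : ∀ x ∈ Ioi (0 : ℝ), 0 ≤ f x) (h : ∫ x in Ioi (0 : ℝ), f x = V) :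
    ∫⁻ x in Ioi (0 : ℝ), ENNReal.ofReal (f x) = ENNReal.ofReal V := by
  have hi : Integrable f (volume.restrict (Ioi 0)) := by
    by_contra hc
    rw [integral_undef hc] at h
    exact hV.ne h
  rw [← h, ofReal_integral_eq_lintegral_ofReal hi]
  exact (ae_restrict_iff' measurableSet_Ioi).2 (Eventually.of_forall hf)

theorem integral_one_sub_cos_mul_exp {s : ℝ} (hs : 0 < s) :
    ∫ x in Ioi (0 : ℝ), (1 - cos x) * exp (-(s * x)) = 1 / (s * (1 + s ^ 2)) := by
  have hs2 : (1 + s ^ 2) ≠ 0 := by positivity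
  have hexp : Tendsto (fun x : ℝ => exp (-(s * x))) atTop (𝓝 0) :=
    tendsto_exp_neg_atTop_nhds_zero.comp (tendsto_id.const_mul_atTop hs)
  have key := integral_Ioi_of_hasDerivAt_of_nonneg' (a := 0) (l := 0)
    (g := fun x => exp (-(s * x)) * (-(1 / s) - (sin x - s * cos x) / (1 + s ^ 2)))
    (g' := fun x => (1 - cos x) * exp (-(s * x))) ?_ ?_ ?_
  · rw [key]
    simp only [mul_zero, neg_zero, exp_zero, sin_zero, cos_zero]
    field_simp
    ring
  · intro x _
    have h1 : HasDerivAt (fun x : ℝ => exp (-(s * x))) (exp (-(s * x)) * (-(s * 1))) x :=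
      (((hasDerivAt_id x).const_mul s).neg).exp
    have h2 : HasDerivAt (fun x : ℝ => -(1 / s) - (sin x - s * cos x) / (1 + s ^ 2))
        (-((cos x - s * (-sin x)) / (1 + s ^ 2))) x :=
      ((((hasDerivAt_sin x).sub ((hasDerivAt_cos x).const_mul s)).div_const _)).const_sub _
    refine (h1.mul h2).congr_deriv ?_
    field_simp
    ring
  · intro x _
    exact mul_nonneg (by linarith [cos_le_one x]) (exp_pos _).le
  · refine hexp.zero_mul_isBoundedUnder_le ?_
    refine isBoundedUnder_of ⟨1 / s + (1 + s) / (1 + s ^ 2), fun x => ?_⟩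
    have h3 : |sin x - s * cos x| ≤ 1 + s := by
      rw [abs_le]
      constructor <;> nlinarith [sin_le_one x, cos_le_one x, neg_one_le_sin x, neg_one_le_cos x]
    simp only [Function.comp, norm_eq_abs]
    refine (abs_sub _ _).trans ?_
    rw [abs_neg, abs_of_pos (by positivity : 0 < 1 / s), abs_div,
      abs_of_pos (by positivity : 0 < 1 + s ^ 2)]
    gcongr

/-- Write Γ(2H+1) x^(-1-2H) as the integral of s^(2H) exp(-xs) and swap; the inner integral is
1/(s(1+s²)). Write 1/(1+s²) as the integral of exp(-(1+s²)r) and swap again; what remains is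
Γ(H)Γ(1-H)/2, and the reflection formula finishes. Working with lower integrals makes both swaps
free of integrability conditions. -/
theorem lintegral_one_sub_cos_mul_rpow {H : ℝ} (h0 : 0 < H) (h1 : H < 1) :
    ∫⁻ x in Ioi (0 : ℝ), ENNReal.ofReal ((1 - cos x) * x ^ (-1 - 2 * H))
      = ENNReal.ofReal (π / (2 * (Gamma (2 * H + 1) * sin (π * H)))) := by
  have hG : 0 < Gamma (2 * H + 1) := Gamma_pos_of_pos (by linarith)
  have hsin : 0 < sin (π * H) := sin_pos_of_pos_of_lt_pi (by positivity) (by nlinarith [pi_pos])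
  have hGH : 0 < Gamma H := Gamma_pos_of_pos h0
  have hGH1 : 0 < Gamma (1 - H) := Gamma_pos_of_pos (by linarith)
  have e1 : ∀ x ∈ Ioi (0 : ℝ),
      ENNReal.ofReal (Gamma (2 * H + 1)) * ENNReal.ofReal ((1 - cos x) * x ^ (-1 - 2 * H))
        = ∫⁻ s in Ioi (0 : ℝ), ENNReal.ofReal ((1 - cos x) * (s ^ (2 * H) * exp (-(x * s)))) := by
    intro x (hx : 0 < x)
    have hc : 0 ≤ 1 - cos x := by linarith [cos_le_one x]
    simp_rw [ENNReal.ofReal_mul hc]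
    rw [lintegral_const_mul' _ _ ENNReal.ofReal_ne_top]
    have := integral_rpow_mul_exp_neg_mul_Ioi (a := 2 * H + 1) (r := x) (by linarith) hx
    rw [add_sub_cancel_right] at this
    rw [lintegral_ofReal_of_integral_eq (by positivity)
      (fun s hs => mul_nonneg (rpow_nonneg (le_of_lt hs) _) (exp_pos _).le) this,
      mul_left_comm, ← ENNReal.ofReal_mul hG.le]
    congr 2
    rw [one_div, inv_rpow hx.le, ← rpow_neg hx.le, mul_comm]
    ring_nf
  have e2 : ∀ s ∈ Ioi (0 : ℝ),
      ∫⁻ x in Ioi (0 : ℝ), ENNReal.ofReal ((1 - cos x) * (s ^ (2 * H) * exp (-(x * s))))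
        -- Both sides equal s^(2H)/(s(1+s²)).
        = ∫⁻ r in Ioi (0 : ℝ), ENNReal.ofReal (s ^ (2 * H - 1) * exp (-(1 + s ^ 2) * r)) := by
    intro s (hs : 0 < s)
    have a1 : ∫ x in Ioi (0 : ℝ), (1 - cos x) * (s ^ (2 * H) * exp (-(x * s)))
        = s ^ (2 * H) * (1 / (s * (1 + s ^ 2))) := by
      rw [← integral_one_sub_cos_mul_exp hs, ← integral_const_mul]
      congr 1 with x
      rw [mul_comm x s]; ring
    have a2 : ∫ r in Ioi (0 : ℝ), s ^ (2 * H - 1) * exp (-(1 + s ^ 2) * r)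
        = s ^ (2 * H) * (1 / (s * (1 + s ^ 2))) := by
      rw [integral_const_mul, integral_exp_mul_Ioi (by nlinarith), rpow_sub hs, rpow_one,
        mul_zero, exp_zero, neg_div_neg_eq]
      field_simp
    rw [lintegral_ofReal_of_integral_eq (by positivity) _ a1,
      lintegral_ofReal_of_integral_eq (by positivity) _ a2]
    · intro r _; positivity
    · intro x _
      exact mul_nonneg (by linarith [cos_le_one x]) (by positivity)
  have e3 : ∀ r ∈ Ioi (0 : ℝ),
      ∫⁻ s in Ioi (0 : ℝ), ENNReal.ofReal (s ^ (2 * H - 1) * exp (-(1 + s ^ 2) * r))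
        = ENNReal.ofReal (Gamma H / 2 * (r ^ ((1 - H) - 1) * exp (-(1 * r)))) := by
    intro r (hr : 0 < r)
    refine lintegral_ofReal_of_integral_eq (by positivity) ?_ ?_
    · intro s (hs : 0 < s); positivity
    · have := integral_rpow_mul_exp_neg_mul_rpow (p := 2) (q := 2 * H - 1) (b := r) two_pos
        (by linarith) hr
      have h2 : ∀ s : ℝ, s ^ (2 * H - 1) * exp (-(1 + s ^ 2) * r)
          = exp (-r) * (s ^ (2 * H - 1) * exp (-r * s ^ (2 : ℝ))) := by
        intro s
        rw [rpow_two, mul_left_comm, ← exp_add]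
        ring_nf
      simp_rw [h2]
      rw [integral_const_mul, this]
      rw [show -(2 * H - 1 + 1) / 2 = 1 - H - 1 by ring, show (2 * H - 1 + 1) / 2 = H by ring,
        one_mul]
      ring
  have e4 : ENNReal.ofReal (Gamma (2 * H + 1)) *
      ∫⁻ x in Ioi (0 : ℝ), ENNReal.ofReal ((1 - cos x) * x ^ (-1 - 2 * H))
      = ENNReal.ofReal (Gamma H / 2 * Gamma (1 - H)) := by
    rw [← lintegral_const_mul' _ _ ENNReal.ofReal_ne_top, setLIntegral_congr_fun measurableSet_Ioi e1,
      lintegral_lintegral_swap, setLIntegral_congr_fun measurableSet_Ioi e2,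
      lintegral_lintegral_swap, setLIntegral_congr_fun measurableSet_Ioi e3]
    · refine lintegral_ofReal_of_integral_eq (by positivity) ?_ ?_
      · intro s (hs : 0 < s); positivity
      · rw [integral_const_mul, integral_rpow_mul_exp_neg_mul_Ioi (by linarith) one_pos]
        simp
    · apply Measurable.aemeasurable
      simp only [Function.uncurry_def]
      fun_prop
    · apply Measurable.aemeasurable
      simp only [Function.uncurry_def]
      fun_prop
  have hne : ENNReal.ofReal (Gamma (2 * H + 1)) ≠ 0 := by simpa using hG
  rw [← ENNReal.mul_right_inj hne ENNReal.ofReal_ne_top, e4, ← ENNReal.ofReal_mul hG.le,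
    div_mul_eq_mul_div, Gamma_mul_Gamma_one_sub]
  congr 1
  field_simp

theorem integral_one_sub_cos_mul_rpow {H : ℝ} (h0 : 0 < H) (h1 : H < 1) :
    ∫ x in Ioi (0 : ℝ), (1 - cos x) * x ^ (-1 - 2 * H)
      = π / (2 * (Gamma (2 * H + 1) * sin (π * H))) := by
  have hG : 0 < Gamma (2 * H + 1) := Gamma_pos_of_pos (by linarith)
  have hsin : 0 < sin (π * H) := sin_pos_of_pos_of_lt_pi (by positivity) (by nlinarith [pi_pos])
  rw [integral_eq_lintegral_of_nonneg_ae, lintegral_one_sub_cos_mul_rpow h0 h1,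
    ENNReal.toReal_ofReal (by positivity)]
  · refine (ae_restrict_iff' measurableSet_Ioi).2 (Eventually.of_forall fun x hx => ?_)
    exact mul_nonneg (by linarith [cos_le_one x]) (rpow_nonneg (le_of_lt hx) _)
  · apply Measurable.aestronglyMeasurable
    fun_prop

theorem integrable_comp_abs_of_integrableOn {f : ℝ → ℝ} (hf : IntegrableOn f (Ioi 0)) :
    Integrable fun x => f |x| := by
  have hp : IntegrableOn (fun x => f |x|) (Ioi 0) :=
    hf.congr_fun (fun x hx => by simp only [abs_of_pos (mem_Ioi.1 hx)]) measurableSet_Ioi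
  rw [← integrableOn_univ, ← Iic_union_Ioi (a := (0 : ℝ)), integrableOn_union]
  refine ⟨?_, hp⟩
  rw [integrableOn_Iic_iff_integrableOn_Iio]
  have := (show IntegrableOn (fun x => f |x|) (Ioi (-0)) by simpa using hp).comp_neg_Iio
  simpa using this

/-- The variogram of fractional noise as a spectral integral. -/
theorem integral_one_sub_cos_mul_abs_rpow {H : ℝ} (h0 : 0 < H) (h1 : H < 1) (t : ℝ) :
    Integrable (fun w : ℝ => (1 - cos (t * w)) * |w| ^ (-1 - 2 * H)) ∧
    ∫ w : ℝ, (1 - cos (t * w)) * |w| ^ (-1 - 2 * H)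
      = |t| ^ (2 * H) * (π / (Gamma (2 * H + 1) * sin (π * H))) := by
  have hG : 0 < Gamma (2 * H + 1) := Gamma_pos_of_pos (by linarith)
  have hsin : 0 < sin (π * H) := sin_pos_of_pos_of_lt_pi (by positivity) (by nlinarith [pi_pos])
  rcases eq_or_ne t 0 with rfl | ht
  · simp [zero_rpow (by linarith : 2 * H ≠ 0)]
  have hT : 0 < |t| := abs_pos.2 ht
  have hfun : (fun w : ℝ => (1 - cos (t * w)) * |w| ^ (-1 - 2 * H))
      = fun w : ℝ => (fun x => (1 - cos (|t| * x)) * x ^ (-1 - 2 * H)) |w| := by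
    ext w
    simp only
    rw [← abs_mul, cos_abs]
  have hval : ∫ x in Ioi (0 : ℝ), (1 - cos (|t| * x)) * x ^ (-1 - 2 * H)
      = |t| ^ (2 * H) * (π / (2 * (Gamma (2 * H + 1) * sin (π * H)))) := by
    have h2 := integral_comp_mul_left_Ioi (fun x => (1 - cos x) * x ^ (-1 - 2 * H)) 0 hT
    rw [mul_zero, integral_one_sub_cos_mul_rpow h0 h1] at h2
    have h3 : ∀ x ∈ Ioi (0 : ℝ), (1 - cos (|t| * x)) * x ^ (-1 - 2 * H)
        = |t| ^ (1 + 2 * H) * ((1 - cos (|t| * x)) * (|t| * x) ^ (-1 - 2 * H)) := by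
      intro x hx
      rw [mul_rpow hT.le (le_of_lt hx), mul_left_comm, ← mul_assoc (|t| ^ _), ← rpow_add hT]
      simp
    rw [setIntegral_congr_fun measurableSet_Ioi h3, integral_const_mul, h2, rpow_add hT, rpow_one,
      smul_eq_mul]
    field_simp
  rw [hfun]
  constructor
  · refine integrable_comp_abs_of_integrableOn
      (f := fun x => (1 - cos (|t| * x)) * x ^ (-1 - 2 * H)) ?_
    by_contra hc
    rw [integral_undef hc] at hval
    have : 0 < |t| ^ (2 * H) * (π / (2 * (Gamma (2 * H + 1) * sin (π * H)))) := by positivity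
    exact this.ne hval
  · rw [integral_comp_abs (f := fun x => (1 - cos (|t| * x)) * x ^ (-1 - 2 * H)), hval]
    field_simp

end OneSubCos

end Carfima

/-! ### Spectral form of the covariance of increments. -/

noncomputable section

namespace Carfima

open Set ComplexConjugate

/-- The character `w ↦ exp(i x w)`. -/
def expI (x w : ℝ) : ℂ := Complex.exp (Complex.I * (x : ℂ) * (w : ℂ))

theorem continuous_expI : Continuous (Function.uncurry expI) := by
  simp only [Function.uncurry_def, expI]; fun_prop

theorem norm_expI (x w : ℝ) : ‖expI x w‖ = 1 := by
  rw [expI, Complex.norm_exp]; simp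

theorem conj_expI (x w : ℝ) : conj (expI x w) = expI (-x) w := by
  rw [expI, expI, ← Complex.exp_conj]; simp

theorem expI_neg_right (x w : ℝ) : expI x (-w) = expI (-x) w := by simp [expI]

theorem expI_add (x y w : ℝ) : expI (x + y) w = expI x w * expI y w := by
  rw [expI, expI, expI, ← Complex.exp_add]; push_cast; ring_nf

theorem expI_sub (x y w : ℝ) : expI (x - y) w = expI x w * expI (-y) w := by
  rw [sub_eq_add_neg, expI_add]

theorem re_expI (x w : ℝ) : (expI x w).re = Real.cos (x * w) := by
  rw [expI, Complex.exp_re]; simp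

theorem expI_zero (w : ℝ) : expI 0 w = 1 := by simp [expI]

/-- The bound separates x from w: the factor 1 + |x| is integrated against the kernel, and two
factors min 1 |w| make the frequency weight integrable. -/
theorem norm_expI_sub_one_le (x w : ℝ) : ‖expI x w - 1‖ ≤ 2 * (1 + |x|) * min 1 |w| := by
  have h1 : ‖expI x w - 1‖ ≤ 2 := by
    refine (norm_sub_le _ _).trans ?_
    rw [norm_expI, norm_one]; norm_num
  have h2 : ‖expI x w - 1‖ ≤ |x| * |w| := by
    have := Real.norm_exp_I_mul_ofReal_sub_one_le (x := x * w)
    rw [Real.norm_eq_abs, abs_mul] at this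
    convert this using 3
    rw [expI]; push_cast; ring_nf
  rcases le_total 1 |w| with h | h
  · rw [min_eq_left h]
    nlinarith [abs_nonneg x]
  · rw [min_eq_right h]
    nlinarith [abs_nonneg x, abs_nonneg w]

theorem norm_expI_sub_le (x y w : ℝ) :
    ‖expI x w - expI y w‖ ≤ 2 * (1 + |x - y|) * min 1 |w| := by
  have : expI x w - expI y w = expI y w * (expI (x - y) w - 1) := by
    rw [mul_sub, ← expI_add]; simp
  rw [this, norm_mul, norm_expI, one_mul]
  exact norm_expI_sub_one_le _ _

/-- The frequency weight `|w|^{-1-2H}` of fractional Brownian motion. -/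
def freqWeight (H w : ℝ) : ℝ := |w| ^ (-1 - 2 * H)

theorem freqWeight_nonneg (H w : ℝ) : 0 ≤ freqWeight H w := Real.rpow_nonneg (abs_nonneg _) _

theorem measurable_freqWeight (H : ℝ) : Measurable (freqWeight H) := by
  unfold freqWeight; fun_prop

/-- Near 0 the exponent is 1 - 2H > -1, by H < 1; at infinity it is -1 - 2H < -1, by H > 0. -/
theorem integrable_min_sq_mul_freqWeight {H : ℝ} (h0 : 0 < H) (h1 : H < 1) :
    Integrable fun w : ℝ => min 1 |w| ^ 2 * freqWeight H w := by
  refine integrable_comp_abs_of_integrableOn (f := fun x => min 1 x ^ 2 * x ^ (-1 - 2 * H)) ?_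
  rw [← Ioc_union_Ioi_eq_Ioi zero_le_one, integrableOn_union]
  constructor
  · have h : IntegrableOn (fun x : ℝ => x ^ (1 - 2 * H)) (Ioc 0 1) :=
      (intervalIntegrable_iff_integrableOn_Ioc_of_le zero_le_one).1
        (intervalIntegral.intervalIntegrable_rpow' (by linarith))
    refine h.congr_fun (fun x hx => ?_) measurableSet_Ioc
    simp only
    rw [min_eq_right hx.2, ← Real.rpow_natCast, ← Real.rpow_add hx.1]
    congr 1
    push_cast; ring
  · have h : IntegrableOn (fun x : ℝ => x ^ (-1 - 2 * H)) (Ioi 1) :=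
      integrableOn_Ioi_rpow_of_lt (by linarith) one_pos
    refine h.congr_fun (fun x hx => ?_) measurableSet_Ioi
    simp only
    rw [min_eq_left (le_of_lt hx)]; simp

theorem integrable_mul_freqWeight {H : ℝ} (h0 : 0 < H) (h1 : H < 1) {φ ψ : ℝ → ℂ}
    (hφ : AEStronglyMeasurable φ) (hψ : AEStronglyMeasurable ψ) {M N : ℝ}
    (hφM : ∀ w, ‖φ w‖ ≤ M * min 1 |w|) (hψN : ∀ w, ‖ψ w‖ ≤ N * min 1 |w|) :
    Integrable fun w => φ w * ψ w * (freqWeight H w : ℂ) := by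
  refine ((integrable_min_sq_mul_freqWeight h0 h1).const_mul (M * N)).mono' ?_
    (Eventually.of_forall fun w => ?_)
  · exact (hφ.mul hψ).mul
      (Complex.measurable_ofReal.comp (measurable_freqWeight H)).aestronglyMeasurable
  · rw [norm_mul, norm_mul, Complex.norm_real, Real.norm_of_nonneg (freqWeight_nonneg _ _)]
    have h3 := mul_le_mul (hφM w) (hψN w) (norm_nonneg _) ((norm_nonneg _).trans (hφM w))
    calc ‖φ w‖ * ‖ψ w‖ * freqWeight H w
        ≤ (M * min 1 |w| * (N * min 1 |w|)) * freqWeight H w :=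
          mul_le_mul_of_nonneg_right h3 (freqWeight_nonneg _ _)
      _ = _ := by ring

/-- The spectral constant `Γ(2H+1) sin(πH) / (2π)` of fractional noise. -/
def specConst (H : ℝ) : ℝ := Real.Gamma (2 * H + 1) * Real.sin (Real.pi * H) / (2 * Real.pi)

theorem continuous_expI_right (x : ℝ) : Continuous (expI x) := by
  unfold expI; fun_prop

/-- Spectral representation of the covariance of increments of fractional Brownian motion. -/
theorem covariance_increments_eq_integral {H : ℝ} (h0 : 0 < H) (h1 : H < 1) (x y z v : ℝ) :
    (((|x - v| ^ (2 * H) + |y - z| ^ (2 * H) - |x - z| ^ (2 * H) - |y - v| ^ (2 * H)) / 2 : ℝ) : ℂ)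
      = specConst H *
        ∫ w, (expI x w - expI y w) * conj (expI z w - expI v w) * (freqWeight H w : ℂ) := by
  have hG : 0 < Real.Gamma (2 * H + 1) := Real.Gamma_pos_of_pos (by linarith)
  have hsin : 0 < Real.sin (Real.pi * H) :=
    Real.sin_pos_of_pos_of_lt_pi (by positivity) (by nlinarith [Real.pi_pos])
  set F : ℝ → ℂ := fun w =>
    (expI x w - expI y w) * conj (expI z w - expI v w) * (freqWeight H w : ℂ) with hF
  have hcont : ∀ x y : ℝ, Continuous fun w => expI x w - expI y w := fun x y =>
    (continuous_expI_right x).sub (continuous_expI_right y)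
  have hint : Integrable F :=
    integrable_mul_freqWeight h0 h1 (hcont x y).aestronglyMeasurable
      (Complex.continuous_conj.comp (hcont z v)).aestronglyMeasurable
      (norm_expI_sub_le x y) (fun w => by rw [RCLike.norm_conj]; exact norm_expI_sub_le z v w)
  -- Conjugating `F` amounts to w ↦ -w, so the integral is real and only cosines have to be
  -- integrated.
  have hconj : conj (∫ w, F w) = ∫ w, F w := by
    rw [← integral_conj, ← integral_neg_eq_self]
    congr 1 with w
    simp only [hF, map_mul, map_sub, conj_expI, expI_neg_right, neg_neg, Complex.conj_ofReal,
      freqWeight, abs_neg]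
  have hre : (∫ w, F w).re = ∫ w, (F w).re := (integral_re hint).symm
  have hval : ∫ w, (F w).re = (|x - v| ^ (2 * H) + |y - z| ^ (2 * H) - |x - z| ^ (2 * H)
      - |y - v| ^ (2 * H)) * (Real.pi / (Real.Gamma (2 * H + 1) * Real.sin (Real.pi * H))) := by
    have hD := integral_one_sub_cos_mul_abs_rpow h0 h1
    -- A single cosine is not integrable against the weight. The four ones inserted here cancel and
    -- make each term integrable.
    have hfun : ∀ w, (F w).re = (1 - Real.cos ((x - v) * w)) * |w| ^ (-1 - 2 * H)
        + (1 - Real.cos ((y - z) * w)) * |w| ^ (-1 - 2 * H)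
        - (1 - Real.cos ((x - z) * w)) * |w| ^ (-1 - 2 * H)
        - (1 - Real.cos ((y - v) * w)) * |w| ^ (-1 - 2 * H) := by
      intro w
      have : F w = (expI (x - z) w - expI (x - v) w - expI (y - z) w + expI (y - v) w)
          * (freqWeight H w : ℂ) := by
        simp only [hF, map_sub, conj_expI, expI_sub]; ring
      rw [this, Complex.re_mul_ofReal]
      simp only [Complex.add_re, Complex.sub_re, re_expI, freqWeight]
      ring
    simp_rw [hfun]
    have i2 := (hD (x - v)).1.fun_add (hD (y - z)).1
    have i3 : Integrable fun w => (1 - Real.cos ((x - v) * w)) * |w| ^ (-1 - 2 * H)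
        + (1 - Real.cos ((y - z) * w)) * |w| ^ (-1 - 2 * H)
        - (1 - Real.cos ((x - z) * w)) * |w| ^ (-1 - 2 * H) := i2.sub (hD (x - z)).1
    rw [integral_sub i3 (hD (y - v)).1,
      integral_sub i2 (hD (x - z)).1, integral_add (hD (x - v)).1 (hD (y - z)).1, (hD _).2, (hD _).2, (hD _).2, (hD _).2]
    ring
  rw [← Complex.conj_eq_iff_re.1 hconj, hre, hval, ← Complex.ofReal_mul, specConst]
  congr 1
  generalize Real.sin (Real.pi * H) = S at hsin
  field_simp

/-! ### Moving averages of increments of a fractional curve in a Hilbert space. -/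

section Curve

variable {E : Type*} [NormedAddCommGroup E] [InnerProductSpace ℝ E]

/-- A curve in a Hilbert space with the covariance kernel of fractional Brownian motion. -/
def IsFractionalCurve (H : ℝ) (b : ℝ → E) : Prop :=
  ∀ x y, inner ℝ (b x) (b y) = (|x| ^ (2 * H) + |y| ^ (2 * H) - |x - y| ^ (2 * H)) / 2

variable {H : ℝ} {b : ℝ → E}

theorem IsFractionalCurve.inner_sub_sub (hb : IsFractionalCurve H b) (x y z v : ℝ) :
    inner ℝ (b x - b y) (b z - b v)
      = (|x - v| ^ (2 * H) + |y - z| ^ (2 * H) - |x - z| ^ (2 * H) - |y - v| ^ (2 * H)) / 2 := by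
  simp only [inner_sub_left, inner_sub_right, hb _ _]
  ring

theorem IsFractionalCurve.norm_sub (hb : IsFractionalCurve H b) (h0 : 0 < H) (x y : ℝ) :
    ‖b x - b y‖ = |x - y| ^ H := by
  have h := hb.inner_sub_sub x y x y
  rw [real_inner_self_eq_norm_sq, sub_self, sub_self, abs_sub_comm y x, abs_zero,
    Real.zero_rpow (by linarith)] at h
  have h2 : |x - y| ^ (2 * H) = (|x - y| ^ H) ^ 2 := by
    rw [← Real.rpow_natCast, ← Real.rpow_mul (abs_nonneg _)]; push_cast; ring_nf
  rw [h2] at h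
  exact (sq_eq_sq₀ (norm_nonneg _) (Real.rpow_nonneg (abs_nonneg _) _)).1 (by linarith)

theorem IsFractionalCurve.continuous (hb : IsFractionalCurve H b) (h0 : 0 < H) :
    Continuous b := by
  rw [continuous_iff_continuousAt]
  intro x
  rw [ContinuousAt, tendsto_iff_norm_sub_tendsto_zero]
  simp_rw [hb.norm_sub h0]
  have : Continuous fun y : ℝ => |y - x| ^ H :=
    (by fun_prop : Continuous fun y : ℝ => |y - x|).rpow_const fun _ => Or.inr h0.le
  simpa [Real.zero_rpow h0.ne'] using this.tendsto x

/-- The moving average of increments of the curve `b` with kernel `k`. -/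
def incrementAverage (b : ℝ → E) (k : ℝ → ℝ) (t : ℝ) : E :=
  ∫ r in Ioi (0 : ℝ), k r • (b (t - r) - b t)

/-- The transfer function of `incrementAverage`. -/
def incrementTransfer (k : ℝ → ℝ) (w : ℝ) : ℂ :=
  ∫ r in Ioi (0 : ℝ), (k r : ℂ) * (expI (-r) w - 1)

variable {k : ℝ → ℝ}

theorem norm_incrementTransfer_le (hkint : IntegrableOn (fun r => |k r| * (1 + |r|)) (Ioi 0))
    (w : ℝ) :
    ‖incrementTransfer k w‖ ≤ 2 * (∫ r in Ioi (0 : ℝ), |k r| * (1 + |r|)) * min 1 |w| := by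
  have h := norm_integral_le_of_norm_le (hkint.mul_const (2 * min 1 |w|))
    (f := fun r => (k r : ℂ) * (expI (-r) w - 1)) (Eventually.of_forall fun r => ?_)
  · rw [integral_mul_const] at h
    refine h.trans (le_of_eq (by ring))
  · rw [norm_mul, Complex.norm_real, Real.norm_eq_abs]
    refine (mul_le_mul_of_nonneg_left (norm_expI_sub_one_le _ _) (abs_nonneg _)).trans ?_
    rw [abs_neg]
    exact le_of_eq (by ring)

theorem continuous_incrementTransfer_integrand (hk : Continuous k) :
    Continuous fun p : ℝ × ℝ => (k p.1 : ℂ) * (expI (-p.1) p.2 - 1) := by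
  have h2 : Continuous fun p : ℝ × ℝ => expI (-p.1) p.2 :=
    continuous_expI.comp (by fun_prop : Continuous fun p : ℝ × ℝ => (-p.1, p.2))
  fun_prop

theorem aestronglyMeasurable_incrementTransfer (hk : Continuous k) :
    AEStronglyMeasurable (incrementTransfer k) := by
  have h : StronglyMeasurable fun p : ℝ × ℝ => (k p.2 : ℂ) * (expI (-p.2) p.1 - 1) :=
    ((continuous_incrementTransfer_integrand hk).comp continuous_swap).stronglyMeasurable
  exact (h.integral_prod_right (ν := volume.restrict (Ioi (0 : ℝ)))).aestronglyMeasurable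

/-- Fubini, with a dominating function that is a product of one in r and one in w. The factor `ψ` is
left general because the lemma is applied twice to a covariance: with `ψ` a conjugated difference of
characters, then with `ψ` the conjugated transfer function. -/
theorem integral_kernel_mul_integral_freqWeight (h0 : 0 < H) (h1 : H < 1) (hk : Continuous k)
    (hkint : IntegrableOn (fun r => |k r| * (1 + |r|)) (Ioi 0)) {ψ : ℝ → ℂ}
    (hψ : AEStronglyMeasurable ψ) {N : ℝ} (hψN : ∀ w, ‖ψ w‖ ≤ N * min 1 |w|) (t : ℝ) :
    ∫ r in Ioi (0 : ℝ), (k r : ℂ) * ∫ w, (expI (t - r) w - expI t w) * ψ w * (freqWeight H w : ℂ)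
      = ∫ w, expI t w * incrementTransfer k w * ψ w * (freqWeight H w : ℂ) := by
  have hprod : Integrable (Function.uncurry fun r w : ℝ =>
      (k r : ℂ) * ((expI (t - r) w - expI t w) * ψ w * (freqWeight H w : ℂ)))
      ((volume.restrict (Ioi 0)).prod volume) := by
    have hdom : Integrable (fun p : ℝ × ℝ => (|k p.1| * (1 + |p.1|)) *
        (2 * N * (min 1 |p.2| ^ 2 * freqWeight H p.2)))
        ((volume.restrict (Ioi 0)).prod volume) :=
      Integrable.mul_prod hkint ((integrable_min_sq_mul_freqWeight h0 h1).const_mul (2 * N))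
    refine hdom.mono' ?_ (Eventually.of_forall fun p => ?_)
    · have h2 : Continuous fun p : ℝ × ℝ => (k p.1 : ℂ) := by fun_prop
      have h3 : Continuous fun p : ℝ × ℝ => expI (t - p.1) p.2 - expI t p.2 :=
        (continuous_expI.comp (by fun_prop : Continuous fun p : ℝ × ℝ => (t - p.1, p.2))).sub
          ((continuous_expI_right t).comp continuous_snd)
      have h4 : AEStronglyMeasurable (fun p : ℝ × ℝ => ψ p.2)
          ((volume.restrict (Ioi 0)).prod volume) := hψ.comp_snd
      have h5 : AEStronglyMeasurable (fun p : ℝ × ℝ => (freqWeight H p.2 : ℂ))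
          ((volume.restrict (Ioi 0)).prod volume) :=
        (Complex.measurable_ofReal.comp
          ((measurable_freqWeight H).comp measurable_snd)).aestronglyMeasurable
      exact h2.aestronglyMeasurable.mul ((h3.aestronglyMeasurable.mul h4).mul h5)
    · simp only [Function.uncurry]
      rw [norm_mul, norm_mul, norm_mul, Complex.norm_real, Complex.norm_real, Real.norm_eq_abs,
        Real.norm_of_nonneg (freqWeight_nonneg _ _)]
      have h6 := norm_expI_sub_le (t - p.1) t p.2
      rw [sub_sub_cancel_left, abs_neg] at h6
      have h7 := mul_le_mul h6 (hψN p.2) (norm_nonneg _) ((norm_nonneg _).trans h6)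
      calc |k p.1| * (‖expI (t - p.1) p.2 - expI t p.2‖ * ‖ψ p.2‖ * freqWeight H p.2)
          ≤ |k p.1| * (2 * (1 + |p.1|) * min 1 |p.2| * (N * min 1 |p.2|) * freqWeight H p.2) :=
            mul_le_mul_of_nonneg_left
              (mul_le_mul_of_nonneg_right h7 (freqWeight_nonneg _ _)) (abs_nonneg _)
        _ = _ := by ring
  simp_rw [← integral_const_mul]
  rw [integral_integral_swap hprod]
  congr 1 with w
  rw [incrementTransfer]
  simp_rw [← integral_const_mul, ← integral_mul_const]
  congr 1 with r
  rw [expI_sub]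
  ring

theorem IsFractionalCurve.integrableOn_smul_sub (hb : IsFractionalCurve H b) (h0 : 0 < H)
    (h1 : H < 1) (hk : Continuous k)
    (hkint : IntegrableOn (fun r => |k r| * (1 + |r|)) (Ioi 0)) (t : ℝ) :
    IntegrableOn (fun r => k r • (b (t - r) - b t)) (Ioi 0) := by
  refine hkint.mono' ?_ (Eventually.of_forall fun r => ?_)
  · have := hb.continuous h0
    exact (by fun_prop : Continuous fun r => k r • (b (t - r) - b t)).aestronglyMeasurable
  · rw [norm_smul, hb.norm_sub h0, Real.norm_eq_abs, sub_sub_cancel_left, abs_neg]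
    refine mul_le_mul_of_nonneg_left ?_ (abs_nonneg _)
    calc |r| ^ H ≤ (1 + |r|) ^ H := Real.rpow_le_rpow (abs_nonneg _) (by linarith) h0.le
      _ ≤ (1 + |r|) ^ (1 : ℝ) :=
        Real.rpow_le_rpow_of_exponent_le (by linarith [abs_nonneg r]) h1.le
      _ = _ := Real.rpow_one _

/-- The covariance of moving averages of increments, as a spectral integral. -/
theorem IsFractionalCurve.inner_incrementAverage [CompleteSpace E] (hb : IsFractionalCurve H b) (h0 : 0 < H)
    (h1 : H < 1) (hk : Continuous k)
    (hkint : IntegrableOn (fun r => |k r| * (1 + |r|)) (Ioi 0)) (s t : ℝ) :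
    ((inner ℝ (incrementAverage b k s) (incrementAverage b k t) : ℝ) : ℂ)
      = specConst H * ∫ w, expI (s - t) w *
          ((‖incrementTransfer k w‖ ^ 2 : ℝ) : ℂ) * (freqWeight H w : ℂ) := by
  have hI := hb.integrableOn_smul_sub h0 h1 hk hkint
  have step : ∀ t x y : ℝ, ((inner ℝ (incrementAverage b k t) (b x - b y) : ℝ) : ℂ)
      = specConst H * ∫ w, expI t w * incrementTransfer k w * conj (expI x w - expI y w)
          * (freqWeight H w : ℂ) := by
    intro t x y
    rw [real_inner_comm, incrementAverage, ← integral_inner (hI t), ← integral_complex_ofReal,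
      ← integral_kernel_mul_integral_freqWeight h0 h1 hk hkint
        (ψ := fun w => conj (expI x w - expI y w))
        (Complex.continuous_conj.comp ((continuous_expI_right x).sub
          (continuous_expI_right y))).aestronglyMeasurable
        (fun w => by rw [RCLike.norm_conj]; exact norm_expI_sub_le x y w) t,
      ← integral_const_mul]
    congr 1 with r
    rw [inner_smul_right, real_inner_comm, Complex.ofReal_mul, hb.inner_sub_sub,
      covariance_increments_eq_integral h0 h1]
    ring
  set N := 2 * ∫ r in Ioi (0 : ℝ), |k r| * (1 + |r|)
  rw [real_inner_comm,
    show incrementAverage b k s = ∫ r in Ioi (0 : ℝ), k r • (b (s - r) - b s) from rfl,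
    ← integral_inner (hI s), ← integral_complex_ofReal]
  have hfin := integral_kernel_mul_integral_freqWeight h0 h1 hk hkint
    (ψ := fun w => conj (expI t w * incrementTransfer k w)) (N := N)
    (Complex.continuous_conj.comp_aestronglyMeasurable
      ((continuous_expI_right t).aestronglyMeasurable.mul
        (aestronglyMeasurable_incrementTransfer hk)))
    (fun w => by
      rw [RCLike.norm_conj, norm_mul, norm_expI, one_mul]
      exact norm_incrementTransfer_le hkint w) s
  have hrhs : ∀ w, expI (s - t) w * ((‖incrementTransfer k w‖ ^ 2 : ℝ) : ℂ) * (freqWeight H w : ℂ)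
      = expI s w * incrementTransfer k w * conj (expI t w * incrementTransfer k w)
        * (freqWeight H w : ℂ) := by
    intro w
    rw [map_mul, conj_expI, expI_sub, ← Complex.normSq_eq_norm_sq, Complex.normSq_eq_conj_mul_self]
    ring
  simp_rw [hrhs]
  rw [← hfin, ← integral_const_mul]
  congr 1 with r
  -- The inner product is real, so it may be conjugated; this moves the conjugate from the increment
  -- at s to the transfer function at t, as `hfin` requires.
  rw [inner_smul_right, Complex.ofReal_mul, ← Complex.conj_ofReal (inner ℝ _ _), step, map_mul,
    Complex.conj_ofReal, ← integral_conj, mul_left_comm]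
  congr 2
  congr 1 with w
  simp only [map_mul, Complex.conj_conj, Complex.conj_ofReal]
  ring

end Curve

end Carfima

end

noncomputable section

namespace Carfima

open Set ComplexConjugate

/-! ### Calculus of the matrix exponential. -/

section MatrixExp

open scoped Matrix.Norms.Operator

theorem map_exp_smul_ofReal {n : ℕ} (A : Matrix (Fin n) (Fin n) ℝ) (t : ℝ) :
    (NormedSpace.exp (t • A)).map Complex.ofReal
      = NormedSpace.exp (t • A.map Complex.ofReal) := by
  have h := NormedSpace.map_exp (Complex.ofRealHom.mapMatrix : Matrix (Fin n) (Fin n) ℝ →+* _)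
    (Continuous.matrix_map continuous_id Complex.continuous_ofReal) (t • A)
  have h2 : Complex.ofRealHom.mapMatrix (t • A) = t • A.map Complex.ofReal := by ext i j; simp
  rw [h2] at h
  exact h

variable {𝕜 : Type*} [RCLike 𝕜] {n : ℕ}

theorem hasDerivAt_exp_smul_mulVec (A : Matrix (Fin n) (Fin n) 𝕜) (v : Fin n → 𝕜) (t : ℝ) :
    HasDerivAt (fun t : ℝ => NormedSpace.exp (t • A) *ᵥ v)
      (NormedSpace.exp (t • A) *ᵥ (A *ᵥ v)) t := by
  have h := hasDerivAt_exp_smul_const (𝕂 := ℝ) A t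
  have h2 := ((Matrix.mulVecBilin ℝ ℝ).flip v).toContinuousLinearMap.hasFDerivAt.comp_hasDerivAt t h
  rw [mulVec_mulVec]
  exact h2

theorem exp_zero_smul_mulVec (A : Matrix (Fin n) (Fin n) 𝕜) (v : Fin n → 𝕜) :
    NormedSpace.exp ((0 : ℝ) • A) *ᵥ v = v := by
  rw [zero_smul, NormedSpace.exp_zero, one_mulVec]

end MatrixExp

/-! ### Exponential decay for stable matrices. -/

section Decay

variable {n : ℕ}

/-- `f` decays exponentially on the half-line `[0, ∞)`. -/
def ExpDecay {E : Type*} [Norm E] (f : ℝ → E) : Prop :=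
  ∃ c > 0, ∃ C, ∀ t : ℝ, 0 ≤ t → ‖f t‖ ≤ C * Real.exp (-(c * t))

/-- The derivative of exp(-tz) exp(tM) v is the same expression with v replaced by (M - z)v, which
is killed by one power less. Induction and the mean value inequality give polynomial growth, without
Jordan forms. -/
theorem norm_exp_smul_mulVec_le_of_pow_apply_eq_zero (M : Matrix (Fin n) (Fin n) ℂ) (z : ℂ) (k : ℕ) :
    ∀ v : Fin n → ℂ, ((Matrix.toLin' M - z • 1) ^ k) v = 0 → ∃ C, 0 ≤ C ∧ ∀ t : ℝ, 0 ≤ t →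
      ‖Complex.exp (-(t * z)) • (NormedSpace.exp (t • M) *ᵥ v)‖ ≤ C * (1 + t) ^ k := by
  induction k with
  | zero =>
    intro v hv
    refine ⟨0, le_rfl, fun t _ => ?_⟩
    have : v = 0 := by simpa using hv
    simp [this]
  | succ k ih =>
    intro v hv
    rw [pow_succ, Module.End.mul_apply] at hv
    obtain ⟨C, hC, h⟩ := ih _ hv
    have hw : (Matrix.toLin' M - z • 1) v = M *ᵥ v - z • v := by simp
    rw [hw] at h
    refine ⟨‖v‖ + C, by positivity, fun t ht => ?_⟩
    have hder : ∀ s : ℝ, HasDerivAt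
        (fun s : ℝ => Complex.exp (-(s * z)) • (NormedSpace.exp (s • M) *ᵥ v))
        (Complex.exp (-(s * z)) • (NormedSpace.exp (s • M) *ᵥ (M *ᵥ v - z • v))) s := by
      intro s
      have h1 : HasDerivAt (fun s : ℝ => Complex.exp (-(s * z)))
          (Complex.exp (-(s * z)) * (-(1 * z))) s :=
        (((Complex.ofRealCLM.hasDerivAt (x := s)).mul_const z).neg).cexp
      refine (h1.smul (hasDerivAt_exp_smul_mulVec M v s)).congr_deriv ?_
      rw [mulVec_sub, mulVec_smul, smul_sub, smul_smul]
      simp [sub_eq_add_neg]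
    have hb := norm_image_sub_le_of_norm_deriv_le_segment' (a := 0) (b := t) (C := C * (1 + t) ^ k)
      (fun s _ => (hder s).hasDerivWithinAt)
      (fun s hs => (h s hs.1).trans (by have := hs.1; have := hs.2.le; gcongr)) t ⟨ht, le_rfl⟩
    simp only [Complex.ofReal_zero, zero_mul, neg_zero, Complex.exp_zero, one_smul,
      exp_zero_smul_mulVec, sub_zero] at hb
    have h1 : (1 : ℝ) ≤ (1 + t) ^ (k + 1) := one_le_pow₀ (by linarith)
    have h2 : C * (1 + t) ^ k * t ≤ C * (1 + t) ^ (k + 1) := by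
      rw [pow_succ, ← mul_assoc]
      exact mul_le_mul_of_nonneg_left (by linarith) (by positivity)
    have h3 := norm_sub_norm_le (Complex.exp (-(t * z)) • (NormedSpace.exp (t • M) *ᵥ v)) v
    have h4 : ‖v‖ * 1 ≤ ‖v‖ * (1 + t) ^ (k + 1) := mul_le_mul_of_nonneg_left h1 (norm_nonneg _)
    linarith

theorem exists_one_add_pow_le_exp (k : ℕ) {c : ℝ} (hc : 0 < c) :
    ∃ C, 0 ≤ C ∧ ∀ t : ℝ, 0 ≤ t → (1 + t) ^ k ≤ C * Real.exp (c * t) := by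
  refine ⟨k.factorial / c ^ k * Real.exp c, by positivity, fun t ht => ?_⟩
  have h := Real.pow_div_factorial_le_exp (c * (1 + t)) (by positivity) k
  have hk : (0 : ℝ) < k.factorial := by positivity
  rw [div_le_iff₀ hk, mul_pow, mul_add, Real.exp_add, mul_one] at h
  rw [div_mul_eq_mul_div, div_mul_eq_mul_div, le_div_iff₀ (by positivity)]
  linarith

theorem ExpDecay.add {E : Type*} [SeminormedAddCommGroup E] {f g : ℝ → E} (hf : ExpDecay f)
    (hg : ExpDecay g) : ExpDecay fun t => f t + g t := by
  obtain ⟨c, hc, C, h⟩ := hf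
  obtain ⟨d, hd, D, h'⟩ := hg
  refine ⟨min c d, lt_min hc hd, |C| + |D|, fun t ht => (norm_add_le _ _).trans ?_⟩
  rw [add_mul]
  refine add_le_add ((h t ht).trans ?_) ((h' t ht).trans ?_)
  · refine mul_le_mul (le_abs_self _) (Real.exp_le_exp.2 ?_) (Real.exp_pos _).le (abs_nonneg _)
    nlinarith [min_le_left c d]
  · refine mul_le_mul (le_abs_self _) (Real.exp_le_exp.2 ?_) (Real.exp_pos _).le (abs_nonneg _)
    nlinarith [min_le_right c d]

/-- Over ℂ the generalized eigenspaces span, and decay is additive in v, so one generalized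
eigenvector at a time suffices. -/
theorem expDecay_exp_smul_mulVec_complex (M : Matrix (Fin n) (Fin n) ℂ)
    (hM : ∀ z : ℂ, Module.End.HasEigenvalue (Matrix.toLin' M) z → z.re < 0) (v : Fin n → ℂ) :
    ExpDecay fun t : ℝ => NormedSpace.exp (t • M) *ᵥ v := by
  have hv : v ∈ ⨆ z, Module.End.maxGenEigenspace (Matrix.toLin' M) z := by
    rw [Module.End.iSup_maxGenEigenspace_eq_top]; trivial
  refine Submodule.iSup_induction
    (motive := fun v => ExpDecay fun t : ℝ => NormedSpace.exp (t • M) *ᵥ v) _ hv ?_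
    ⟨1, one_pos, 0, fun t _ => by simp⟩
    (fun x y hx hy => by simpa only [mulVec_add] using hx.add hy)
  · intro z v hv
    obtain ⟨k, hk⟩ := (Module.End.mem_maxGenEigenspace _ _ _).1 hv
    rcases eq_or_ne v 0 with rfl | hv0
    · exact ⟨1, one_pos, 0, fun t _ => by simp⟩
    have hz : z.re < 0 := by
      refine hM z (Module.End.hasEigenvalue_of_hasGenEigenvalue (k := k) ?_)
      rw [Module.End.hasGenEigenvalue_iff]
      intro hbot
      refine hv0 ((Submodule.mem_bot ℂ).1 (hbot ▸ ?_))
      rwa [Module.End.mem_genEigenspace_nat, LinearMap.mem_ker]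
    obtain ⟨C, hC, h⟩ := norm_exp_smul_mulVec_le_of_pow_apply_eq_zero M z k v hk
    -- Half of the rate -Re z absorbs the polynomial factor; the other half is the rate of decay.
    obtain ⟨D, hD, hk'⟩ := exists_one_add_pow_le_exp k (c := -z.re / 2) (by linarith)
    refine ⟨-z.re / 2, by linarith, C * D, fun t ht => ?_⟩
    have h1 := h t ht
    rw [norm_smul, Complex.norm_exp] at h1
    have h2 : (-((t : ℂ) * z)).re = -(t * z.re) := by simp
    rw [h2, Real.exp_neg, inv_mul_le_iff₀ (Real.exp_pos _)] at h1
    refine h1.trans ?_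
    calc Real.exp (t * z.re) * (C * (1 + t) ^ k)
        ≤ Real.exp (t * z.re) * (C * (D * Real.exp (-z.re / 2 * t))) := by
          have := hk' t ht
          gcongr
      _ = C * D * (Real.exp (t * z.re) * Real.exp (-z.re / 2 * t)) := by ring
      _ = _ := by rw [← Real.exp_add]; ring_nf

theorem map_mulVec_ofReal (A : Matrix (Fin n) (Fin n) ℝ) (v : Fin n → ℝ) :
    (fun i => (((A *ᵥ v) i : ℝ) : ℂ)) = A.map Complex.ofReal *ᵥ fun i => (v i : ℂ) := by
  ext i
  simp [mulVec, dotProduct]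

theorem expDecay_exp_smul_mulVec {A : Matrix (Fin n) (Fin n) ℝ} (hA : IsStable A)
    (v : Fin n → ℝ) : ExpDecay fun t : ℝ => NormedSpace.exp (t • A) *ᵥ v := by
  obtain ⟨c, hc, C, h⟩ := expDecay_exp_smul_mulVec_complex (A.map Complex.ofReal) hA
    fun i => (v i : ℂ)
  refine ⟨c, hc, C, fun t ht => le_trans (le_of_eq ?_) (h t ht)⟩
  simp only
  rw [← map_exp_smul_ofReal, ← map_mulVec_ofReal, Pi.norm_def, Pi.norm_def]
  simp

theorem ExpDecay.dotProduct {f : ℝ → Fin n → ℝ} (hf : ExpDecay f) (β : Fin n → ℝ) :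
    ExpDecay fun t => β ⬝ᵥ f t := by
  obtain ⟨c, hc, C, h⟩ := hf
  refine ⟨c, hc, (∑ i, |β i|) * C, fun t ht => ?_⟩
  simp only [_root_.dotProduct]
  rw [Finset.sum_mul, Finset.sum_mul]
  refine (norm_sum_le _ _).trans (Finset.sum_le_sum fun i _ => ?_)
  rw [norm_mul, Real.norm_eq_abs, mul_assoc]
  exact mul_le_mul_of_nonneg_left ((norm_le_pi_norm _ _).trans (h t ht)) (abs_nonneg _)

theorem ExpDecay.tendsto_pow_mul {E : Type*} [SeminormedAddCommGroup E] {f : ℝ → E}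
    (hf : ExpDecay f) (k : ℕ) : Tendsto (fun t => t ^ k * ‖f t‖) atTop (𝓝 0) := by
  obtain ⟨c, hc, C, h⟩ := hf
  have h1 := (Real.tendsto_pow_mul_exp_neg_atTop_nhds_zero k).comp (tendsto_id.const_mul_atTop hc)
  have h2 : Tendsto (fun t : ℝ => C / c ^ k * ((c * t) ^ k * Real.exp (-(c * t)))) atTop (𝓝 0) := by
    simpa using h1.const_mul (C / c ^ k)
  refine squeeze_zero' ?_ ?_ h2
  · filter_upwards [eventually_ge_atTop 0] with t ht; positivity
  · filter_upwards [eventually_ge_atTop 0] with t ht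
    refine (mul_le_mul_of_nonneg_left (h t ht) (by positivity)).trans (le_of_eq ?_)
    rw [mul_pow]
    field_simp

theorem ExpDecay.tendsto {E : Type*} [SeminormedAddCommGroup E] {f : ℝ → E}
    (hf : ExpDecay f) : Tendsto f atTop (𝓝 0) := by
  rw [tendsto_zero_iff_norm_tendsto_zero]
  simpa using hf.tendsto_pow_mul 0

/-- The weight 1 + |r| dominates |r|^H, the norm of an increment of the curve over a lag r. -/
theorem ExpDecay.integrableOn_mul {E : Type*} [NormedAddCommGroup E] {f : ℝ → E}
    (hf : ExpDecay f) (hc : Continuous f) :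
    IntegrableOn (fun r => ‖f r‖ * (1 + |r|)) (Ioi 0) := by
  obtain ⟨c, hc0, C, h⟩ := hf
  obtain ⟨D, hD, hk⟩ := exists_one_add_pow_le_exp 1 (c := c / 2) (by linarith)
  have hi : IntegrableOn (fun r => C * D * Real.exp (-(c / 2) * r)) (Ioi 0) :=
    (integrableOn_exp_mul_Ioi (by linarith) 0).const_mul _
  refine hi.mono' ?_ ((ae_restrict_iff' measurableSet_Ioi).2 (Eventually.of_forall ?_))
  · exact (by fun_prop : Continuous fun r => ‖f r‖ * (1 + |r|)).aestronglyMeasurable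
  · intro r (hr : 0 < r)
    have h0 : 0 ≤ C * Real.exp (-(c * r)) := (norm_nonneg _).trans (h r hr.le)
    rw [norm_mul, norm_norm, abs_of_pos hr, Real.norm_of_nonneg (by linarith)]
    calc ‖f r‖ * (1 + r) ≤ (C * Real.exp (-(c * r))) * (D * Real.exp (c / 2 * r)) :=
          mul_le_mul (h r hr.le) (by simpa using hk r hr.le) (by linarith) h0
      _ = C * D * (Real.exp (-(c * r)) * Real.exp (c / 2 * r)) := by ring
      _ = _ := by rw [← Real.exp_add]; ring_nf

theorem ExpDecay.integrableOn {E : Type*} [NormedAddCommGroup E] {f : ℝ → E}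
    (hf : ExpDecay f) (hc : Continuous f) : IntegrableOn f (Ioi 0) := by
  refine (hf.integrableOn_mul hc).mono' hc.aestronglyMeasurable (Eventually.of_forall fun r => ?_)
  nlinarith [norm_nonneg (f r), abs_nonneg r]

end Decay

/-! ### The kernel and its transfer function. -/

section Kernel

variable {p : ℕ}

/-- The kernel `β' exp(A r) v`. -/
def kernel (A : Matrix (Fin p) (Fin p) ℝ) (β v : Fin p → ℝ) (r : ℝ) : ℝ :=
  β ⬝ᵥ (NormedSpace.exp (r • A) *ᵥ v)

theorem hasDerivAt_dotProduct {𝕜 : Type*} [RCLike 𝕜] (β : Fin p → 𝕜) {f : ℝ → Fin p → 𝕜}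
    {f' : Fin p → 𝕜} {t : ℝ} (hf : HasDerivAt f f' t) :
    HasDerivAt (fun t => β ⬝ᵥ f t) (β ⬝ᵥ f') t := by
  simp only [dotProduct]
  exact HasDerivAt.fun_sum fun i _ => ((hasDerivAt_pi.1 hf i).const_mul (β i))

variable (A : Matrix (Fin p) (Fin p) ℝ) (β v : Fin p → ℝ)

theorem hasDerivAt_kernel (r : ℝ) : HasDerivAt (kernel A β v) (kernel A β (A *ᵥ v) r) r :=
  hasDerivAt_dotProduct β (hasDerivAt_exp_smul_mulVec A v r)

theorem continuous_kernel : Continuous (kernel A β v) :=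
  continuous_iff_continuousAt.2 fun r => (hasDerivAt_kernel A β v r).continuousAt

theorem kernel_zero : kernel A β v 0 = β ⬝ᵥ v := by rw [kernel, exp_zero_smul_mulVec]

variable {A}

theorem expDecay_kernel (hA : IsStable A) : ExpDecay (kernel A β v) :=
  (expDecay_exp_smul_mulVec hA v).dotProduct β

/-- The transfer function of the differentiated kernel through the Fourier transform of the kernel. -/
theorem incrementTransfer_kernel (hA : IsStable A) (w : ℝ) :
    incrementTransfer (kernel A β (A *ᵥ v)) w
      = Complex.I * w * ∫ r in Ioi (0 : ℝ), expI (-r) w * (kernel A β v r : ℂ) := by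
  have hcont : Continuous fun r => expI (-r) w := by unfold expI; fun_prop
  have hg := (expDecay_kernel β v hA).integrableOn (continuous_kernel A β v)
  have hk := (expDecay_kernel β (A *ᵥ v) hA).integrableOn (continuous_kernel A β _)
  have hbd : ∀ u : Fin p → ℝ, IntegrableOn (kernel A β u) (Ioi 0) →
      IntegrableOn (fun r => expI (-r) w * (kernel A β u r : ℂ)) (Ioi 0) := by
    intro u hu
    exact hu.ofReal.bdd_mul (c := 1) hcont.aestronglyMeasurable
      (Eventually.of_forall fun r => (norm_expI _ _).le)
  have i1 : IntegrableOn (fun r => (kernel A β (A *ᵥ v) r : ℂ) * (expI (-r) w - 1)) (Ioi 0) := by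
    refine ((hbd _ hk).sub hk.ofReal).congr (Eventually.of_forall fun r => ?_)
    simp only [Pi.sub_apply, RCLike.ofReal]
    simp
    ring
  have i2 : IntegrableOn (fun r => Complex.I * w * (expI (-r) w * (kernel A β v r : ℂ))) (Ioi 0) :=
    (hbd _ hg).const_mul _
  -- This primitive vanishes at 0, where the character is 1, and at infinity, where the kernel
  -- decays; there are no boundary terms.
  have hder : ∀ r ∈ Ici (0 : ℝ), HasDerivAt (fun r => (kernel A β v r : ℂ) * (expI (-r) w - 1))
      ((kernel A β (A *ᵥ v) r : ℂ) * (expI (-r) w - 1)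
        - Complex.I * w * (expI (-r) w * (kernel A β v r : ℂ))) r := by
    intro r _
    have h1 : HasDerivAt (fun r : ℝ => expI (-r) w) (expI (-r) w * (-(Complex.I * w))) r := by
      have h2 : HasDerivAt (fun r : ℝ => Complex.I * ((-r : ℝ) : ℂ) * (w : ℂ))
          (-(Complex.I * w)) r := by
        have h3 := ((Complex.ofRealCLM.hasDerivAt (x := r)).neg.const_mul Complex.I).mul_const
          (w : ℂ)
        simpa using h3
      exact h2.cexp
    refine ((hasDerivAt_kernel A β v r).ofReal_comp.mul (h1.sub_const 1)).congr_deriv ?_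
    ring
  have hlim : Tendsto (fun r => (kernel A β v r : ℂ) * (expI (-r) w - 1)) atTop (𝓝 0) := by
    rw [tendsto_zero_iff_norm_tendsto_zero]
    have h4 := ((expDecay_kernel β v hA).tendsto.norm.mul_const 2)
    rw [norm_zero, zero_mul] at h4
    refine squeeze_zero (fun r => norm_nonneg _) (fun r => ?_) h4
    rw [norm_mul, Complex.norm_real]
    refine mul_le_mul_of_nonneg_left ((norm_sub_le _ _).trans ?_) (norm_nonneg _)
    rw [norm_expI, norm_one]; norm_num
  have h := integral_Ioi_of_hasDerivAt_of_tendsto' hder (i1.sub i2) hlim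
  rw [integral_sub i1 i2, integral_const_mul, neg_zero, expI_zero, sub_self, mul_zero, sub_zero,
    sub_eq_zero] at h
  exact h

end Kernel

/-! ### The companion matrix and the rational transfer function. -/

section Companion

variable {p : ℕ} (α : ℕ → ℝ)

/-- The Vandermonde vector `(1, z, …, z^{p-1})`. -/
def vanderVec (p : ℕ) (z : ℂ) : Fin p → ℂ := fun i => z ^ (i : ℕ)

/-- The superdiagonal shifts the powers of z; only the last row misses z^p, by exactly α(z). This
yields both the eigenvectors at the roots of α and the Fourier transform of the kernel. -/
theorem companion_mulVec_vanderVec (z : ℂ) :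
    (companion p α).map Complex.ofReal *ᵥ vanderVec p z
      = z • vanderVec p z - alphaPoly p α z • fun i => ((deltaVec p i : ℝ) : ℂ) := by
  ext i
  simp only [mulVec, dotProduct, Matrix.map_apply, companion, vanderVec, Pi.sub_apply,
    Pi.smul_apply, deltaVec, smul_eq_mul]
  by_cases hi : (i : ℕ) + 1 = p
  · simp only [hi, if_true, Complex.ofReal_one, mul_one, alphaPoly]
    have hs : ∑ j ∈ Finset.Icc 1 p, (α j : ℂ) * z ^ (j - 1)
        = ∑ j : Fin p, (α (j + 1) : ℂ) * z ^ (j : ℕ) := by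
      have hshift := Finset.sum_Ico_add' (fun j => (α j : ℂ) * z ^ (j - 1)) 0 p 1
      simp only [Nat.add_sub_cancel] at hshift
      rw [← Finset.sum_range fun j => (α (j + 1) : ℂ) * z ^ j, Finset.range_eq_Ico, hshift]
      rfl
    rw [hs, ← pow_succ', hi]
    ring
  · simp only [hi, if_false, Complex.ofReal_zero, mul_zero, sub_zero]
    have hlt : (i : ℕ) + 1 < p := lt_of_le_of_ne i.2 hi
    rw [Finset.sum_eq_single (⟨i + 1, hlt⟩ : Fin p)]
    · simp [pow_succ']
    · intro j _ hj
      have : (j : ℕ) ≠ i + 1 := fun h => hj (Fin.ext h)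
      simp [this]
    · simp

theorem alphaPoly_ne_zero (hp : 0 < p) {α : ℕ → ℝ} (hA : IsStable (companion p α)) {z : ℂ}
    (hz : 0 ≤ z.re) : alphaPoly p α z ≠ 0 := by
  intro h0
  have h := companion_mulVec_vanderVec (p := p) α z
  rw [h0, zero_smul, sub_zero] at h
  have hv : vanderVec p z ≠ 0 := fun h1 => by
    have := congrFun h1 ⟨0, hp⟩
    simp [vanderVec] at this
  refine hz.not_gt (hA z (Module.End.hasEigenvalue_of_hasEigenvector
    (x := vanderVec p z) (Module.End.hasEigenvector_iff.2 ⟨?_, hv⟩)))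
  rw [Module.End.mem_eigenspace_iff, Matrix.toLin'_apply]
  exact h

theorem betaVec_dotProduct_vanderVec {q : ℕ} (hqp : q < p) (β : ℕ → ℝ) (z : ℂ) :
    (fun i => ((betaVec p q β i : ℝ) : ℂ)) ⬝ᵥ vanderVec p z = betaPoly q β z := by
  simp only [dotProduct, betaVec, vanderVec, betaPoly]
  rw [← Finset.sum_range
    fun i => (((if i = 0 then 1 else if i ≤ q then β i else 0 : ℝ)) : ℂ) * z ^ i]
  rw [← Finset.sum_subset (s₁ := Finset.range (q + 1))]
  · rw [Finset.sum_range_succ', add_comm, Finset.range_eq_Ico,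
      Finset.sum_Ico_add' (fun j => ((if j = 0 then 1 else if j ≤ q then β j else 0 : ℝ) : ℂ)
        * z ^ j) 0 q 1]
    simp only [if_true, Complex.ofReal_one, pow_zero, mul_one]
    congr 1
    refine Finset.sum_congr rfl fun j hj => ?_
    have hj2 := Finset.mem_Icc.1 hj
    rw [if_neg (by omega), if_pos (by omega)]
  · intro j hj
    simp only [Finset.mem_range] at hj ⊢
    omega
  · intro j _ hj
    simp only [Finset.mem_range] at hj
    rw [if_neg (by omega), if_neg (by omega)]
    simp

/-- With z = iw and v the Vandermonde vector at z, the derivative of exp(-zr) β' exp(Ar) v is -α(z)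
exp(-zr) times the kernel. Integrating over r > 0 leaves the boundary value β'v = β(z), so no
resolvent has to be inverted. -/
theorem integral_expI_mul_kernel {q : ℕ} (hqp : q < p) {α : ℕ → ℝ} (β : ℕ → ℝ)
    (hA : IsStable (companion p α)) (w : ℝ) :
    ∫ r in Ioi (0 : ℝ), expI (-r) w * (kernel (companion p α) (betaVec p q β) (deltaVec p) r : ℂ)
      = betaPoly q β (Complex.I * w) / alphaPoly p α (Complex.I * w) := by
  set z : ℂ := Complex.I * w
  have hα : alphaPoly p α z ≠ 0 := alphaPoly_ne_zero (by omega) hA (by simp [z])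
  set M := (companion p α).map Complex.ofReal
  set βc : Fin p → ℂ := fun i => ((betaVec p q β i : ℝ) : ℂ)
  set δc : Fin p → ℂ := fun i => ((deltaVec p i : ℝ) : ℂ)
  have hker : ∀ r, (kernel (companion p α) (betaVec p q β) (deltaVec p) r : ℂ)
      = βc ⬝ᵥ (NormedSpace.exp (r • M) *ᵥ δc) := by
    intro r
    rw [← map_exp_smul_ofReal, ← map_mulVec_ofReal]
    simp [kernel, dotProduct, βc]
  have hint : IntegrableOn (fun r => expI (-r) w *
      (kernel (companion p α) (betaVec p q β) (deltaVec p) r : ℂ)) (Ioi 0) := by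
    have hcont : Continuous fun r => expI (-r) w := by unfold expI; fun_prop
    exact ((expDecay_kernel _ _ hA).integrableOn (continuous_kernel _ _ _)).ofReal.bdd_mul (c := 1)
      hcont.aestronglyMeasurable (Eventually.of_forall fun r => (norm_expI _ _).le)
  have hder : ∀ r ∈ Ici (0 : ℝ), HasDerivAt
      (fun r => expI (-r) w * (βc ⬝ᵥ (NormedSpace.exp (r • M) *ᵥ vanderVec p z)))
      (-alphaPoly p α z * (expI (-r) w *
        (kernel (companion p α) (betaVec p q β) (deltaVec p) r : ℂ))) r := by
    intro r _
    have h1 : HasDerivAt (fun r : ℝ => expI (-r) w) (expI (-r) w * (-z)) r := by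
      have h2 : HasDerivAt (fun r : ℝ => Complex.I * ((-r : ℝ) : ℂ) * (w : ℂ)) (-z) r := by
        have h3 := ((Complex.ofRealCLM.hasDerivAt (x := r)).neg.const_mul Complex.I).mul_const
          (w : ℂ)
        simpa [z] using h3
      exact h2.cexp
    refine (h1.mul (hasDerivAt_dotProduct βc
      (hasDerivAt_exp_smul_mulVec M (vanderVec p z) r))).congr_deriv ?_
    rw [companion_mulVec_vanderVec, mulVec_sub, mulVec_smul, mulVec_smul, dotProduct_sub,
      dotProduct_smul, dotProduct_smul, hker, smul_eq_mul, smul_eq_mul]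
    ring
  have hlim : Tendsto
      (fun r => expI (-r) w * (βc ⬝ᵥ (NormedSpace.exp (r • M) *ᵥ vanderVec p z))) atTop (𝓝 0) := by
    have h5 := (expDecay_exp_smul_mulVec_complex M hA (vanderVec p z)).tendsto
    have h6 : Tendsto (fun r : ℝ => βc ⬝ᵥ (NormedSpace.exp (r • M) *ᵥ vanderVec p z)) atTop
        (𝓝 (βc ⬝ᵥ 0)) :=
      ((by fun_prop : Continuous fun u : Fin p → ℂ => βc ⬝ᵥ u).tendsto 0).comp h5
    rw [dotProduct_zero, tendsto_zero_iff_norm_tendsto_zero] at h6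
    rw [tendsto_zero_iff_norm_tendsto_zero]
    refine h6.congr fun r => ?_
    rw [norm_mul, norm_expI, one_mul]
  have h := integral_Ioi_of_hasDerivAt_of_tendsto' hder (hint.const_mul _) hlim
  rw [integral_const_mul, neg_zero, expI_zero, exp_zero_smul_mulVec,
    betaVec_dotProduct_vanderVec hqp, one_mul, zero_sub, neg_mul, neg_inj] at h
  rw [eq_div_iff hα, mul_comm, h]

/-- The transform at w = 0. Multiplied by α_0, this is the mean -α_0/α_1 of the process. -/
theorem integral_kernel_companion {q : ℕ} (hqp : q < p) {α : ℕ → ℝ} (β : ℕ → ℝ)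
    (hA : IsStable (companion p α)) :
    ∫ r in Ioi (0 : ℝ), kernel (companion p α) (betaVec p q β) (deltaVec p) r = -(1 / α 1) := by
  have h := integral_expI_mul_kernel hqp β hA 0
  have h1 : ∀ r, expI r 0 = 1 := fun r => by simp [expI]
  have hα : alphaPoly p α 0 = -(α 1 : ℂ) := by
    rw [alphaPoly, zero_pow (by omega), Finset.sum_eq_single 1]
    · simp
    · intro j hj hj1
      simp only [Finset.mem_Icc] at hj
      rw [zero_pow (by omega), mul_zero]
    · intro h2
      exact absurd (Finset.mem_Icc.2 ⟨le_rfl, by omega⟩) h2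
  have hβ : betaPoly q β 0 = 1 := by
    rw [betaPoly, Finset.sum_eq_zero, add_zero]
    intro j hj
    simp only [Finset.mem_Icc] at hj
    rw [zero_pow (by omega), mul_zero]
  simp only [h1, one_mul, Complex.ofReal_zero, mul_zero, hα, hβ] at h
  rw [integral_complex_ofReal] at h
  have h3 : ((-(1 / α 1) : ℝ) : ℂ) = 1 / -(α 1 : ℂ) := by push_cast; ring
  rw [← h3] at h
  exact_mod_cast h

end Companion

end Carfima

end

noncomputable section

namespace Carfima

open Set

/-! ### Riemann sums along a continuous curve. -/

section RiemannSum

variable {E : Type*} [NormedAddCommGroup E] [NormedSpace ℝ E]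

/-- The integral `∫_a^t f db` along a curve `b`, with `f'` the derivative of `f`, defined by
integration by parts. -/
def byParts (b : ℝ → E) (f f' : ℝ → ℝ) (a t : ℝ) : E :=
  f t • b t - f a • b a - ∫ u in a..t, f' u • b u

/-- The Riemann sum of `f` along the curve `b`, for the points `u` and the tags `τ`. -/
def riemannSum (b : ℝ → E) (f : ℝ → ℝ) (n : ℕ) (u τ : ℕ → ℝ) : E :=
  ∑ k ∈ Finset.range n, f (τ k) • (b (u (k + 1)) - b (u k))

/-- Tagged partitions of `[a, t]` with mesh at most `δ`. -/
def IsTaggedPartition (a t δ : ℝ) (n : ℕ) (u τ : ℕ → ℝ) : Prop :=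
  u 0 = a ∧ u n = t ∧ ∀ k < n, u k ≤ τ k ∧ τ k ≤ u (k + 1) ∧ u (k + 1) - u k ≤ δ

theorem IsTaggedPartition.mem_Icc {a t δ : ℝ} {n : ℕ} {u τ : ℕ → ℝ}
    (h : IsTaggedPartition a t δ n u τ) {k : ℕ} (hk : k ≤ n) : u k ∈ Icc a t := by
  obtain ⟨h0, hn, h⟩ := h
  -- The sequence `u` is unconstrained beyond n, so it is frozen there.
  have hm : Monotone fun k => u (min k n) := by
    refine monotone_nat_of_le_succ fun k => ?_
    rcases lt_or_ge k n with hkn | hkn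
    · rw [min_eq_left hkn.le, min_eq_left (Nat.succ_le_of_lt hkn)]
      exact (h k hkn).1.trans (h k hkn).2.1
    · rw [min_eq_right hkn, min_eq_right (by omega)]
  have h1 := hm (Nat.zero_le k)
  have h2 := hm hk
  simp only [Nat.zero_min, min_eq_left hk, min_self, h0, hn] at h1 h2
  exact ⟨h1, h2⟩

theorem exists_isTaggedPartition {a t δ : ℝ} (hat : a ≤ t) (hδ : 0 < δ) :
    ∃ n u τ, IsTaggedPartition a t δ n u τ := by
  obtain ⟨n, hn⟩ := exists_nat_gt ((t - a) / δ)
  have hn0 : (0 : ℝ) < n := lt_of_le_of_lt (div_nonneg (by linarith) hδ.le) hn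
  rw [div_lt_iff₀ hδ] at hn
  have hstep : ∀ k : ℕ, a + ((k + 1 : ℕ) : ℝ) * ((t - a) / n) - (a + k * ((t - a) / n))
      = (t - a) / n := fun k => by push_cast; ring
  have hpos : 0 ≤ (t - a) / n := div_nonneg (by linarith) hn0.le
  refine ⟨n, fun k => a + k * ((t - a) / n), fun k => a + k * ((t - a) / n), by simp, ?_, ?_⟩
  · field_simp; ring
  · intro k _
    refine ⟨le_rfl, by linarith [hstep k], ?_⟩
    rw [hstep, div_le_iff₀ hn0]
    linarith

variable {b : ℝ → E} {f f' : ℝ → ℝ}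

theorem sum_byParts (hb : Continuous b) (hf' : Continuous f') (n : ℕ) (u : ℕ → ℝ) :
    ∑ k ∈ Finset.range n, byParts b f f' (u k) (u (k + 1)) = byParts b f f' (u 0) (u n) := by
  simp only [byParts]
  rw [Finset.sum_sub_distrib, Finset.sum_range_sub (fun k => f (u k) • b (u k)),
    intervalIntegral.sum_integral_adjacent_intervals]
  exact fun k _ => (hf'.smul hb).intervalIntegrable _ _

variable [CompleteSpace E]

/-- The error on one cell is the integral of f' (b - b u) over [u, τ] plus that of f' (b - b v) over
[τ, v]. Only the oscillation of `b` enters, so `b` may have unbounded variation. -/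
theorem norm_smul_sub_byParts_le (hb : Continuous b) (hf : ∀ s, HasDerivAt f (f' s) s)
    (hf' : Continuous f') {u τ v M η : ℝ} (hu : u ≤ τ) (hv : τ ≤ v)
    (hM : ∀ s ∈ Icc u v, |f' s| ≤ M)
    (hη : ∀ x ∈ Icc u v, ∀ y ∈ Icc u v, ‖b x - b y‖ ≤ η) :
    ‖f τ • (b v - b u) - byParts b f f' u v‖ ≤ M * η * (v - u) := by
  have hint : ∀ x y : ℝ, ∫ s in x..y, f' s = f y - f x := fun x y =>
    intervalIntegral.integral_eq_sub_of_hasDerivAt (fun s _ => hf s) (hf'.intervalIntegrable _ _)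
  have hi : ∀ x y : ℝ, IntervalIntegrable (fun s => f' s • b s) volume x y :=
    fun x y => (hf'.smul hb).intervalIntegrable _ _
  have hi' : ∀ (c : E) (x y : ℝ), IntervalIntegrable (fun s => f' s • c) volume x y :=
    fun c x y => (hf'.smul continuous_const).intervalIntegrable _ _
  have hpart : ∀ (c : E) (x y : ℝ), ∫ s in x..y, f' s • (b s - c)
      = (∫ s in x..y, f' s • b s) - (f y - f x) • c := by
    intro c x y
    simp only [smul_sub]
    rw [intervalIntegral.integral_sub (hi x y) (hi' c x y),
      intervalIntegral.integral_smul_const, hint]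
  have key : f τ • (b v - b u) - byParts b f f' u v
      = (∫ s in u..τ, f' s • (b s - b u)) + ∫ s in τ..v, f' s • (b s - b v) := by
    rw [hpart, hpart, byParts, ← intervalIntegral.integral_add_adjacent_intervals (hi u τ) (hi τ v)]
    module
  have hM0 : 0 ≤ M := (abs_nonneg _).trans (hM u ⟨le_rfl, hu.trans hv⟩)
  have b1 : ‖∫ s in u..τ, f' s • (b s - b u)‖ ≤ M * η * |τ - u| := by
    refine intervalIntegral.norm_integral_le_of_norm_le_const fun s hs => ?_
    rw [uIoc_of_le hu] at hs
    have hs' : s ∈ Icc u v := ⟨hs.1.le, hs.2.trans hv⟩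
    rw [norm_smul]
    exact mul_le_mul (hM s hs') (hη s hs' u ⟨le_rfl, hu.trans hv⟩) (norm_nonneg _) hM0
  have b2 : ‖∫ s in τ..v, f' s • (b s - b v)‖ ≤ M * η * |v - τ| := by
    refine intervalIntegral.norm_integral_le_of_norm_le_const fun s hs => ?_
    rw [uIoc_of_le hv] at hs
    have hs' : s ∈ Icc u v := ⟨hu.trans hs.1.le, hs.2⟩
    rw [norm_smul]
    exact mul_le_mul (hM s hs') (hη s hs' v ⟨hu.trans hv, le_rfl⟩) (norm_nonneg _) hM0
  rw [abs_of_nonneg (by linarith)] at b1 b2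
  rw [key]
  refine (norm_add_le _ _).trans ((add_le_add b1 b2).trans (le_of_eq (by ring)))

/-- Riemann sums along a continuous curve converge when the integrand is continuously
differentiable. -/
theorem exists_mesh_norm_riemannSum_sub_byParts_le (hb : Continuous b)
    (hf : ∀ s, HasDerivAt f (f' s) s) (hf' : Continuous f') {a t : ℝ} (hat : a ≤ t) {ε : ℝ}
    (hε : 0 < ε) :
    ∃ δ > 0, ∀ n u τ, IsTaggedPartition a t δ n u τ →
      ‖riemannSum b f n u τ - byParts b f f' a t‖ ≤ ε := by
  obtain ⟨M, hM⟩ := isCompact_Icc.exists_bound_of_continuousOn (s := Icc a t) hf'.continuousOn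
  have hM0 : 0 ≤ M := (norm_nonneg _).trans (hM a ⟨le_rfl, hat⟩)
  -- The cell errors add up to at most M η (t - a); the +1 keeps the denominator positive when that
  -- product degenerates.
  have hη : 0 < ε / (M * (t - a) + 1) :=
    div_pos hε (by have := mul_nonneg hM0 (sub_nonneg.2 hat); linarith)
  set η := ε / (M * (t - a) + 1) with hηdef
  have huc := isCompact_Icc.uniformContinuousOn_of_continuous (s := Icc a t) hb.continuousOn
  obtain ⟨δ, hδ, hclose⟩ := Metric.uniformContinuousOn_iff.1 huc η hη
  refine ⟨δ / 2, by linarith, fun n u τ h => ?_⟩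
  have hmem := fun k hk => h.mem_Icc (k := k) hk
  obtain ⟨h0, hn, hstep⟩ := h
  rw [← h0, ← hn, ← sum_byParts hb hf', riemannSum, ← Finset.sum_sub_distrib]
  have hbound : ∀ k ∈ Finset.range n,
      ‖f (τ k) • (b (u (k + 1)) - b (u k)) - byParts b f f' (u k) (u (k + 1))‖
        ≤ M * η * (u (k + 1) - u k) := by
    intro k hk
    have hkn := Finset.mem_range.1 hk
    obtain ⟨hl, hr, hmesh⟩ := hstep k hkn
    have hsub : Icc (u k) (u (k + 1)) ⊆ Icc a t :=
      Icc_subset_Icc (hmem k hkn.le).1 (hmem (k + 1) hkn).2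
    refine norm_smul_sub_byParts_le hb hf hf' hl hr (fun s hs => hM s (hsub hs)) ?_
    intro x hx y hy
    rw [← dist_eq_norm]
    refine (hclose x (hsub hx) y (hsub hy) ?_).le
    rw [Real.dist_eq, abs_lt]
    constructor <;> linarith [hx.1, hx.2, hy.1, hy.2]
  refine (norm_sum_le _ _).trans ((Finset.sum_le_sum hbound).trans ?_)
  rw [← Finset.mul_sum, Finset.sum_range_sub, h0, hn, hηdef, mul_div_assoc', div_mul_eq_mul_div,
    div_le_iff₀ (by have := mul_nonneg hM0 (sub_nonneg.2 hat); linarith)]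
  nlinarith

theorem tendsto_riemannSum_byParts (hb : Continuous b) (hf : ∀ s, HasDerivAt f (f' s) s)
    (hf' : Continuous f') {a t : ℝ} (hat : a ≤ t) {n : ℕ → ℕ} {u τ : ℕ → ℕ → ℝ}
    (hp : ∀ m : ℕ, IsTaggedPartition a t (1 / ((m : ℝ) + 1)) (n m) (u m) (τ m)) :
    Tendsto (fun m => riemannSum b f (n m) (u m) (τ m)) atTop (𝓝 (byParts b f f' a t)) := by
  rw [tendsto_iff_norm_sub_tendsto_zero, Metric.tendsto_atTop]
  intro ε hε
  obtain ⟨δ, hδ, h⟩ := exists_mesh_norm_riemannSum_sub_byParts_le hb hf hf' hat (half_pos hε)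
  obtain ⟨N, hN⟩ := exists_nat_one_div_lt hδ
  refine ⟨N, fun m hm => ?_⟩
  have hmesh : 1 / ((m : ℝ) + 1) ≤ δ :=
    (one_div_le_one_div_of_le (by positivity) (by gcongr)).trans hN.le
  obtain ⟨h0, hn, hst⟩ := hp m
  rw [Real.dist_0_eq_abs, abs_norm]
  exact (h _ _ _ ⟨h0, hn, fun k hk => ⟨(hst k hk).1, (hst k hk).2.1,
    (hst k hk).2.2.trans hmesh⟩⟩).trans_lt (by linarith)

end RiemannSum

/-! ### Mean-square integrals: existence, uniqueness, agreement with pathwise integrals. -/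

section MeanSquare

variable {Ω : Type*} [MeasurableSpace Ω] {P : Measure Ω} {B : ℝ → Ω → ℝ} {f f' : ℝ → ℝ}

/-- A square-integrable process as a curve in `L²`. -/
def curveLp (P : Measure Ω) (B : ℝ → Ω → ℝ) (hB : ∀ t, MemLp (B t) 2 P) (t : ℝ) : Lp ℝ 2 P :=
  (hB t).toLp (B t)

theorem coeFn_riemannSum_curveLp (hB : ∀ t, MemLp (B t) 2 P) (f : ℝ → ℝ) (n : ℕ) (u τ : ℕ → ℝ) :
    (riemannSum (curveLp P B hB) f n u τ : Lp ℝ 2 P)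
      =ᵐ[P] fun ω => riemannSum (fun t => B t ω) f n u τ := by
  induction n with
  | zero =>
    simp only [riemannSum, Finset.range_zero, Finset.sum_empty]
    exact Lp.coeFn_zero _ _ _
  | succ n ih =>
    simp only [riemannSum, Finset.sum_range_succ] at ih ⊢
    filter_upwards [ih, Lp.coeFn_add (∑ k ∈ Finset.range n,
        f (τ k) • (curveLp P B hB (u (k + 1)) - curveLp P B hB (u k)))
        (f (τ n) • (curveLp P B hB (u (n + 1)) - curveLp P B hB (u n))),
      Lp.coeFn_smul (f (τ n)) (curveLp P B hB (u (n + 1)) - curveLp P B hB (u n)),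
      Lp.coeFn_sub (curveLp P B hB (u (n + 1))) (curveLp P B hB (u n)),
      (hB (u (n + 1))).coeFn_toLp, (hB (u n)).coeFn_toLp] with ω h1 h2 h3 h4 h5 h6
    rw [h2, Pi.add_apply, h1, h3, Pi.smul_apply, h4, Pi.sub_apply, curveLp, curveLp, h5, h6]

theorem eLpNorm_riemannSum_sub (hB : ∀ t, MemLp (B t) 2 P) (f : ℝ → ℝ) (n : ℕ) (u τ : ℕ → ℝ)
    (J : Lp ℝ 2 P) :
    eLpNorm (fun ω => (∑ k ∈ Finset.range n, f (τ k) * (B (u (k + 1)) ω - B (u k) ω)) - J ω) 2 P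
      = ENNReal.ofReal ‖riemannSum (curveLp P B hB) f n u τ - J‖ := by
  rw [ofReal_norm, Lp.enorm_def]
  refine eLpNorm_congr_ae ?_
  filter_upwards [coeFn_riemannSum_curveLp hB f n u τ,
    Lp.coeFn_sub (riemannSum (curveLp P B hB) f n u τ) J] with ω h1 h2
  rw [h2, Pi.sub_apply, h1]
  rfl

theorem isIntegral_byParts (hB : ∀ t, MemLp (B t) 2 P) (hc : Continuous (curveLp P B hB))
    (hf : ∀ s, HasDerivAt f (f' s) s) (hf' : Continuous f') {a t : ℝ} (hat : a ≤ t) :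
    IsIntegral P B f a t (byParts (curveLp P B hB) f f' a t : Lp ℝ 2 P) := by
  refine ⟨Lp.memLp _, fun ε hε => ?_⟩
  obtain ⟨δ, hδ, h⟩ := exists_mesh_norm_riemannSum_sub_byParts_le hc hf hf' hat hε
  refine ⟨δ, hδ, fun n u τ h0 hn hp => ?_⟩
  rw [eLpNorm_riemannSum_sub hB]
  exact ENNReal.ofReal_le_ofReal (h n u τ ⟨h0, hn, hp⟩)

theorem eLpNorm_sub_triangle {X Y Z : Ω → ℝ} (hX : MemLp X 2 P) (hY : MemLp Y 2 P)
    (hZ : MemLp Z 2 P) :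
    eLpNorm (fun ω => X ω - Y ω) 2 P
      ≤ eLpNorm (fun ω => Z ω - Y ω) 2 P + eLpNorm (fun ω => Z ω - X ω) 2 P := by
  have h : (fun ω => X ω - Y ω) = (fun ω => Z ω - Y ω) - fun ω => Z ω - X ω := by
    ext ω; simp
  rw [h]
  exact eLpNorm_sub_le (hZ.sub hY).aestronglyMeasurable (hZ.sub hX).aestronglyMeasurable
    one_le_two

theorem ae_eq_of_forall_eLpNorm_le {X Y : Ω → ℝ} (hX : MemLp X 2 P) (hY : MemLp Y 2 P)
    (h : ∀ ε : ℝ, 0 < ε → ∃ Z, MemLp Z 2 P ∧ eLpNorm (fun ω => Z ω - Y ω) 2 P ≤ ENNReal.ofReal ε ∧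
      eLpNorm (fun ω => Z ω - X ω) 2 P ≤ ENNReal.ofReal ε) : X =ᵐ[P] Y := by
  have h0 : eLpNorm (fun ω => X ω - Y ω) 2 P = 0 := by
    refine le_antisymm (ENNReal.le_of_forall_pos_le_add fun ε hε _ => ?_) zero_le
    obtain ⟨Z, hZ, h1, h2⟩ := h (ε / 2) (by positivity)
    refine (eLpNorm_sub_triangle hX hY hZ).trans ((add_le_add h1 h2).trans ?_)
    rw [← ENNReal.ofReal_add (by positivity) (by positivity), add_halves, zero_add,
      ENNReal.ofReal_coe_nnreal]
  have hm : AEStronglyMeasurable (fun ω => X ω - Y ω) P := (hX.sub hY).aestronglyMeasurable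
  rw [eLpNorm_eq_zero_iff hm two_ne_zero] at h0
  filter_upwards [h0] with ω hω
  exact sub_eq_zero.1 hω

/-- One Riemann sum on a partition fine enough for both lies close to both. -/
theorem IsIntegral.ae_eq (hB : ∀ t, MemLp (B t) 2 P) {a t : ℝ} (hat : a ≤ t) {J J' : Ω → ℝ}
    (hJ : IsIntegral P B f a t J) (hJ' : IsIntegral P B f a t J') : J =ᵐ[P] J' := by
  refine ae_eq_of_forall_eLpNorm_le hJ.1 hJ'.1 fun ε hε => ?_
  obtain ⟨δ, hδ, h⟩ := hJ.2 ε hε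
  obtain ⟨δ', hδ', h'⟩ := hJ'.2 ε hε
  obtain ⟨n, u, τ, h0, hn, hp⟩ := exists_isTaggedPartition hat (lt_min hδ hδ')
  refine ⟨fun ω => ∑ k ∈ Finset.range n, f (τ k) * (B (u (k + 1)) ω - B (u k) ω), ?_,
    h' n u τ h0 hn fun k hk => ⟨(hp k hk).1, (hp k hk).2.1, (hp k hk).2.2.trans (min_le_right _ _)⟩,
    h n u τ h0 hn fun k hk => ⟨(hp k hk).1, (hp k hk).2.1, (hp k hk).2.2.trans (min_le_left _ _)⟩⟩
  exact memLp_finsetSum _ fun k _ => ((hB _).sub (hB _)).const_mul _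

theorem IsIntegralIic.ae_eq (hB : ∀ t, MemLp (B t) 2 P) {t : ℝ} {J J' : Ω → ℝ}
    (hJ : IsIntegralIic P B f t J) (hJ' : IsIntegralIic P B f t J') : J =ᵐ[P] J' := by
  obtain ⟨hJm, K, hK, hlim⟩ := hJ
  obtain ⟨hJm', K', hK', hlim'⟩ := hJ'
  refine ae_eq_of_forall_eLpNorm_le hJm hJm' fun ε hε => ?_
  have hε' : 0 < ENNReal.ofReal ε := ENNReal.ofReal_pos.2 hε
  obtain ⟨a, ha, ha', hat⟩ := ((hlim.eventually (ge_mem_nhds hε')).and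
    ((hlim'.eventually (ge_mem_nhds hε')).and (eventually_lt_atBot t))).exists
  refine ⟨K a, (hK a hat).1, ?_, ha⟩
  refine (eLpNorm_congr_ae ?_).trans_le ha'
  filter_upwards [(hK a hat).ae_eq hB hat.le (hK' a hat)] with ω hω
  rw [hω]

/-- The mean-square integral agrees with the pathwise integral if the paths are continuous. -/
theorem ae_eq_byParts_of_continuous [IsFiniteMeasure P] (hB : ∀ t, MemLp (B t) 2 P)
    (hc : Continuous (curveLp P B hB)) (hpath : ∀ᵐ ω ∂P, Continuous fun t => B t ω)
    (hf : ∀ s, HasDerivAt f (f' s) s) (hf' : Continuous f') {a t : ℝ} (hat : a ≤ t) :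
    (byParts (curveLp P B hB) f f' a t : Lp ℝ 2 P)
      =ᵐ[P] fun ω => byParts (fun t => B t ω) f f' a t := by
  have hpart : ∀ m : ℕ, ∃ n u τ, IsTaggedPartition a t (1 / ((m : ℝ) + 1)) n u τ := fun m =>
    exists_isTaggedPartition hat (by positivity)
  choose n u τ hp using hpart
  -- The same Riemann sums converge in L² and almost surely, and limits in measure are unique.
  refine tendstoInMeasure_ae_unique (u := atTop)
    (tendstoInMeasure_of_tendsto_Lp (tendsto_riemannSum_byParts hc hf hf' hat hp))
    (tendstoInMeasure_of_tendsto_ae (fun m => (Lp.memLp _).aestronglyMeasurable) ?_)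
  filter_upwards [hpath, ae_all_iff.2 fun m =>
    coeFn_riemannSum_curveLp hB f (n m) (u m) (τ m)] with ω h1 h2
  simp_rw [h2]
  exact tendsto_riemannSum_byParts h1 hf hf' hat hp

end MeanSquare

end Carfima

end

noncomputable section

namespace Carfima

open Set

/-! ### Convolution kernels and the limit a → -∞. -/

section Shift

variable {E : Type*} [NormedAddCommGroup E] [NormedSpace ℝ E] [CompleteSpace E]
  {b : ℝ → E} {g k : ℝ → ℝ}

theorem hasDerivAt_comp_const_sub (hg : ∀ r, HasDerivAt g (k r) r) (t s : ℝ) :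
    HasDerivAt (fun u => g (t - u)) (-k (t - s)) s := by
  simpa using (hg (t - s)).comp_const_sub t s

/-- Since `k` integrates to g(t - a) - g(0), the term g(0) b(t) can be absorbed by centring the
curve at b(t). The centred form has a limit depending only on increments. -/
theorem byParts_comp_const_sub (hb : Continuous b) (hg : ∀ r, HasDerivAt g (k r) r)
    (hk : Continuous k) (a t : ℝ) :
    byParts b (fun u => g (t - u)) (fun u => -k (t - u)) a t
      = (∫ r in (0 : ℝ)..(t - a), k r • (b (t - r) - b t)) - g (t - a) • (b a - b t) := by
  have h1 : ∫ u in a..t, -k (t - u) • b u = -∫ r in (0 : ℝ)..(t - a), k r • b (t - r) := by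
    have h := intervalIntegral.integral_comp_sub_left (a := a) (b := t)
      (fun r => k r • b (t - r)) t
    simp only [sub_sub_cancel, sub_self] at h
    simp only [neg_smul, intervalIntegral.integral_neg, h]
  have h2 : ∫ r in (0 : ℝ)..(t - a), k r = g (t - a) - g 0 :=
    intervalIntegral.integral_eq_sub_of_hasDerivAt (fun s _ => hg s) (hk.intervalIntegrable _ _)
  have i1 : IntervalIntegrable (fun r => k r • b (t - r)) volume 0 (t - a) :=
    (by fun_prop : Continuous fun r => k r • b (t - r)).intervalIntegrable _ _
  have i2 : IntervalIntegrable (fun r => k r • b t) volume 0 (t - a) :=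
    (by fun_prop : Continuous fun r => k r • b t).intervalIntegrable _ _
  simp only [byParts, smul_sub, sub_self]
  rw [h1, intervalIntegral.integral_sub i1 i2, intervalIntegral.integral_smul_const, h2]
  module

end Shift

section Limit

variable {E : Type*} [NormedAddCommGroup E] [InnerProductSpace ℝ E] [CompleteSpace E]
  {b : ℝ → E} {g k : ℝ → ℝ} {H : ℝ}

/-- The boundary term is at most ‖g(r)‖ (1 + r) with r = t - a, which is why `hlim` is needed for
the powers 0 and 1. -/
theorem IsFractionalCurve.tendsto_byParts (hb : IsFractionalCurve H b) (h0 : 0 < H) (h1 : H < 1)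
    (hg : ∀ r, HasDerivAt g (k r) r) (hk : Continuous k)
    (hkint : IntegrableOn (fun r => |k r| * (1 + |r|)) (Ioi 0))
    (hlim : ∀ j : ℕ, Tendsto (fun r => r ^ j * ‖g r‖) atTop (𝓝 0)) (t : ℝ) :
    Tendsto (fun a => byParts b (fun u => g (t - u)) (fun u => -k (t - u)) a t) atBot
      (𝓝 (incrementAverage b k t)) := by
  have hbc := hb.continuous h0
  simp_rw [byParts_comp_const_sub hbc hg hk]
  have hta : Tendsto (fun a : ℝ => t - a) atBot atTop := by
    simpa only [sub_eq_add_neg] using tendsto_atTop_add_const_left _ t tendsto_neg_atBot_atTop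
  have l1 := intervalIntegral_tendsto_integral_Ioi 0 (hb.integrableOn_smul_sub h0 h1 hk hkint t) hta
  have l2 : Tendsto (fun a => g (t - a) • (b a - b t)) atBot (𝓝 0) := by
    rw [tendsto_zero_iff_norm_tendsto_zero]
    have l3 := ((hlim 0).add (hlim 1)).comp hta
    rw [add_zero] at l3
    refine squeeze_zero' (Eventually.of_forall fun a => norm_nonneg _) ?_ l3
    filter_upwards [eventually_le_atBot t] with a ha
    have hr : 0 ≤ t - a := by linarith
    rw [norm_smul, hb.norm_sub h0, abs_sub_comm, abs_of_nonneg hr]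
    have hle : (t - a) ^ H ≤ 1 + (t - a) :=
      calc (t - a) ^ H ≤ (1 + (t - a)) ^ H := Real.rpow_le_rpow hr (by linarith) h0.le
        _ ≤ (1 + (t - a)) ^ (1 : ℝ) := Real.rpow_le_rpow_of_exponent_le (by linarith) h1.le
        _ = _ := Real.rpow_one _
    calc ‖g (t - a)‖ * (t - a) ^ H ≤ ‖g (t - a)‖ * (1 + (t - a)) :=
          mul_le_mul_of_nonneg_left hle (norm_nonneg _)
      _ = _ := by simp only [Function.comp]; ring
  simpa [incrementAverage] using l1.sub l2

end Limit

/-! ### Fractional Brownian motion as a curve in L², means and covariances. -/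

section SecondOrder

variable {Ω : Type*} [MeasurableSpace Ω] {P : Measure Ω} {B : ℝ → Ω → ℝ} {H : ℝ}

/-- Gaussianity enters only here; the rest uses the mean and the covariance kernel. -/
theorem IsFBM.memLp (hB : IsFBM P H B) (t : ℝ) : MemLp (B t) 2 P :=
  (hB.gaussian.hasGaussianLaw_eval t).memLp_two

theorem IsFBM.isFractionalCurve (hB : IsFBM P H B) :
    IsFractionalCurve H (curveLp P B hB.memLp) := by
  intro x y
  rw [L2.inner_def, ← hB.kernel y x]
  refine integral_congr_ae ?_
  filter_upwards [(hB.memLp x).coeFn_toLp, (hB.memLp y).coeFn_toLp] with ω h1 h2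
  simp only [curveLp, h1, h2]
  simp [mul_comm]

theorem IsFBM.continuous_curveLp (hB : IsFBM P H B) (h0 : 0 < H) :
    Continuous (curveLp P B hB.memLp) :=
  hB.isFractionalCurve.continuous h0

theorem IsFBM.isIntegralIic_incrementAverage (hB : IsFBM P H B) (h0 : 0 < H) (h1 : H < 1)
    {g k : ℝ → ℝ} (hg : ∀ r, HasDerivAt g (k r) r) (hk : Continuous k)
    (hkint : IntegrableOn (fun r => |k r| * (1 + |r|)) (Ioi 0))
    (hlim : ∀ j : ℕ, Tendsto (fun r => r ^ j * ‖g r‖) atTop (𝓝 0)) (t : ℝ) :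
    IsIntegralIic P B (fun u => g (t - u)) t
      (incrementAverage (curveLp P B hB.memLp) k t : Lp ℝ 2 P) := by
  refine ⟨Lp.memLp _, fun a => (byParts (curveLp P B hB.memLp) (fun u => g (t - u))
    (fun u => -k (t - u)) a t : Lp ℝ 2 P), fun a hat => ?_, ?_⟩
  · exact isIntegral_byParts hB.memLp (hB.continuous_curveLp h0)
      (fun s => hasDerivAt_comp_const_sub hg t s) (by fun_prop) hat.le
  · have h := hB.isFractionalCurve.tendsto_byParts h0 h1 hg hk hkint hlim t
    rw [Lp.tendsto_Lp_iff_tendsto_eLpNorm'] at h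
    exact h

theorem covariance_eq_of_ae_eq {Y₁ Y₂ : Ω → ℝ} (Z₁ Z₂ : Lp ℝ 2 P) (m σ : ℝ)
    (h₁ : ∀ᵐ ω ∂P, Y₁ ω = m + σ * Z₁ ω) (h₂ : ∀ᵐ ω ∂P, Y₂ ω = m + σ * Z₂ ω)
    (e₁ : ∫ ω, Y₁ ω ∂P = m) (e₂ : ∫ ω, Y₂ ω ∂P = m) :
    cov[Y₁, Y₂; P] = σ ^ 2 * inner ℝ Z₁ Z₂ := by
  rw [covariance, e₁, e₂, L2.inner_def, ← integral_const_mul]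
  refine integral_congr_ae ?_
  filter_upwards [h₁, h₂] with ω h3 h4
  rw [h3, h4]
  simp
  ring

variable [IsProbabilityMeasure P]

/-- As an inner product with 1, the expectation commutes with the Bochner integral that defines
`incrementAverage`. -/
theorem integral_eq_inner_const (f : Lp ℝ 2 P) :
    ∫ ω, f ω ∂P = inner ℝ ((memLp_const (1 : ℝ)).toLp (fun _ : Ω => (1 : ℝ)) : Lp ℝ 2 P) f := by
  rw [L2.inner_def]
  refine integral_congr_ae ?_
  filter_upwards [(memLp_const (μ := P) (p := 2) (1 : ℝ)).coeFn_toLp] with ω h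
  rw [h]
  simp

theorem IsFBM.integral_incrementAverage (hB : IsFBM P H B) (h0 : 0 < H) (h1 : H < 1)
    {k : ℝ → ℝ} (hk : Continuous k)
    (hkint : IntegrableOn (fun r => |k r| * (1 + |r|)) (Ioi 0)) (t : ℝ) :
    ∫ ω, (incrementAverage (curveLp P B hB.memLp) k t : Lp ℝ 2 P) ω ∂P = 0 := by
  have hz : ∀ s, inner ℝ ((memLp_const (1 : ℝ)).toLp (fun _ : Ω => (1 : ℝ)) : Lp ℝ 2 P)
      (curveLp P B hB.memLp s) = 0 := by
    intro s
    rw [← integral_eq_inner_const, ← hB.mean s]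
    exact integral_congr_ae (hB.memLp s).coeFn_toLp
  rw [integral_eq_inner_const, incrementAverage,
    ← integral_inner (hB.isFractionalCurve.integrableOn_smul_sub h0 h1 hk hkint t)]
  simp only [inner_smul_right, inner_sub_right, hz, sub_self, mul_zero, integral_zero]

end SecondOrder

/-! ### Spectral density of the moving average. -/

section Main

variable {Ω : Type*} [MeasurableSpace Ω] {P : Measure Ω}
  {B : ℝ → Ω → ℝ} {H : ℝ} {p q : ℕ} {α β : ℕ → ℝ} {σ : ℝ}

/-- The factor |iw|² of the transfer function shifts the exponent -1 - 2H by 2. At w = 0 and H = 1/2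
this fails for σ ≠ 0: the transfer function vanishes, while 0^0 = 1 on the right. -/
theorem carfimaDensity_eq (hqp : q < p) (hA : IsStable (companion p α)) {w : ℝ} (hw : w ≠ 0) :
    σ ^ 2 * (specConst H * (‖incrementTransfer (kernel (companion p α) (betaVec p q β)
      (companion p α *ᵥ deltaVec p)) w‖ ^ 2 * freqWeight H w))
      = carfimaDensity p q α β H σ w := by
  have hw' : 0 < |w| := abs_pos.2 hw
  rw [incrementTransfer_kernel _ _ hA, integral_expI_mul_kernel hqp β hA, norm_mul, norm_mul,
    Complex.norm_I, Complex.norm_real, Real.norm_eq_abs, norm_div, freqWeight, carfimaDensity,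
    specConst, show (1 : ℝ) - 2 * H = 2 + (-1 - 2 * H) by ring, Real.rpow_add hw', Real.rpow_two]
  ring

theorem carfimaDensity_nonneg (h0 : 0 < H) (h1 : H < 1) (w : ℝ) :
    0 ≤ carfimaDensity p q α β H σ w := by
  have hG : 0 < Real.Gamma (2 * H + 1) := Real.Gamma_pos_of_pos (by linarith)
  have hsin : 0 < Real.sin (Real.pi * H) :=
    Real.sin_pos_of_pos_of_lt_pi (by positivity) (by nlinarith [Real.pi_pos])
  unfold carfimaDensity
  positivity

theorem carfimaDensity_ae_eq (hqp : q < p) (hA : IsStable (companion p α)) :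
    ∀ᵐ w, σ ^ 2 * (specConst H * (‖incrementTransfer (kernel (companion p α) (betaVec p q β)
      (companion p α *ᵥ deltaVec p)) w‖ ^ 2 * freqWeight H w)) = carfimaDensity p q α β H σ w := by
  filter_upwards [compl_mem_ae_iff.2 (measure_singleton (0 : ℝ))] with w hw
  exact carfimaDensity_eq hqp hA hw

theorem integrableOn_kernel_mul {A : Matrix (Fin p) (Fin p) ℝ} (hA : IsStable A)
    (β v : Fin p → ℝ) : IntegrableOn (fun r => |kernel A β v r| * (1 + |r|)) (Ioi 0) :=
  (expDecay_kernel β v hA).integrableOn_mul (continuous_kernel A β v)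

theorem integrable_carfimaDensity (hqp : q < p) (hA : IsStable (companion p α)) (h0 : 0 < H)
    (h1 : H < 1) : Integrable (carfimaDensity p q α β H σ) := by
  set k := kernel (companion p α) (betaVec p q β) (companion p α *ᵥ deltaVec p)
  have hk : Continuous k := continuous_kernel _ _ _
  have hkint := integrableOn_kernel_mul hA (betaVec p q β) (companion p α *ᵥ deltaVec p)
  have hm := Complex.continuous_ofReal.comp_aestronglyMeasurable
    (aestronglyMeasurable_incrementTransfer hk).norm
  have h := integrable_mul_freqWeight h0 h1 hm hm
    (fun w => by
      rw [Complex.norm_real, norm_norm]; exact norm_incrementTransfer_le hkint w)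
    (fun w => by
      rw [Complex.norm_real, norm_norm]; exact norm_incrementTransfer_le hkint w)
  refine (((h.re).const_mul (specConst H)).const_mul (σ ^ 2)).congr ?_
  filter_upwards [carfimaDensity_ae_eq (H := H) (σ := σ) (β := β) hqp hA] with w hw
  rw [← hw, ← Complex.ofReal_mul, ← Complex.ofReal_mul]
  simp only [RCLike.re_to_complex, Complex.ofReal_re]
  rw [sq ‖_‖]

theorem isMovingAverage_incrementAverage (hA : IsStable (companion p α)) (h0 : 0 < H)
    (h1 : H < 1) (hB : IsFBM P H B) (t : ℝ) :
    IsIntegralIic P B (fun u => betaVec p q β ⬝ᵥ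
        (NormedSpace.exp ((t - u) • companion p α) *ᵥ deltaVec p)) t
      (incrementAverage (curveLp P B hB.memLp) (kernel (companion p α) (betaVec p q β)
        (companion p α *ᵥ deltaVec p)) t : Lp ℝ 2 P) :=
  hB.isIntegralIic_incrementAverage h0 h1
    (hasDerivAt_kernel (companion p α) (betaVec p q β) (deltaVec p)) (continuous_kernel _ _ _)
    (integrableOn_kernel_mul hA _ _) (expDecay_kernel _ _ hA).tendsto_pow_mul t

theorem IsMovingAverage.ae_eq (hA : IsStable (companion p α))
    (h0 : 0 < H) (h1 : H < 1) (hB : IsFBM P H B) {Y : ℝ → Ω → ℝ}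
    (hY : IsMovingAverage P B p q α β σ Y) (t : ℝ) :
    ∀ᵐ ω ∂P, Y t ω = -(α 0 / α 1) + σ * (incrementAverage (curveLp P B hB.memLp)
      (kernel (companion p α) (betaVec p q β) (companion p α *ᵥ deltaVec p)) t : Lp ℝ 2 P) ω := by
  obtain ⟨J, hJ, h⟩ := hY t
  filter_upwards [h, hJ.ae_eq hB.memLp (isMovingAverage_incrementAverage hA h0 h1 hB t)]
    with ω h2 h3
  rw [h2, h3]

variable [IsProbabilityMeasure P]

theorem IsFBM.memLp_and_integral_and_covariance (hB : IsFBM P H B) (h0 : 0 < H) (h1 : H < 1)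
    {k : ℝ → ℝ} (hk : Continuous k)
    (hkint : IntegrableOn (fun r => |k r| * (1 + |r|)) (Ioi 0)) {m : ℝ} {Y : ℝ → Ω → ℝ}
    (hY : ∀ t, ∀ᵐ ω ∂P, Y t ω = m + σ *
      (incrementAverage (curveLp P B hB.memLp) k t : Lp ℝ 2 P) ω) :
    (∀ t, MemLp (Y t) 2 P) ∧ (∀ t, ∫ ω, Y t ω ∂P = m) ∧
    ∀ s t, ((cov[Y s, Y t; P] : ℝ) : ℂ) = ((σ ^ 2 : ℝ) : ℂ) * (specConst H * ∫ w, expI (s - t) w *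
          ((‖incrementTransfer k w‖ ^ 2 : ℝ) : ℂ) * (freqWeight H w : ℂ)) := by
  have hmem : ∀ t, MemLp (Y t) 2 P := fun t =>
    MemLp.ae_eq ((hY t).mono fun ω h => h.symm)
      ((memLp_const m).add ((Lp.memLp (incrementAverage (curveLp P B hB.memLp) k t)).const_mul σ))
  have hmean : ∀ t, ∫ ω, Y t ω ∂P = m := by
    intro t
    have hi : Integrable (incrementAverage (curveLp P B hB.memLp) k t : Lp ℝ 2 P) P :=
      (Lp.memLp _).integrable one_le_two
    rw [integral_congr_ae (hY t), integral_add (integrable_const _) (hi.const_mul σ),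
      integral_const_mul, hB.integral_incrementAverage h0 h1 hk hkint]
    simp
  refine ⟨hmem, hmean, fun s t => ?_⟩
  rw [covariance_eq_of_ae_eq _ _ m σ (hY s) (hY t) (hmean s) (hmean t),
    Complex.ofReal_mul, hB.isFractionalCurve.inner_incrementAverage h0 h1 hk hkint]

theorem IsMovingAverage.hasSpectralDensity (hqp : q < p) (hA : IsStable (companion p α))
    (h0 : 0 < H) (h1 : H < 1) (hB : IsFBM P H B) {Y : ℝ → Ω → ℝ}
    (hY : IsMovingAverage P B p q α β σ Y) :
    HasSpectralDensity P Y (carfimaDensity p q α β H σ) := by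
  obtain ⟨hmem, hmean, hcov⟩ := hB.memLp_and_integral_and_covariance h0 h1
    (continuous_kernel _ _ _) (integrableOn_kernel_mul hA _ _) (hY.ae_eq hA h0 h1 hB)
  refine ⟨hmem, fun s t => by rw [hmean, hmean], carfimaDensity_nonneg h0 h1,
    integrable_carfimaDensity hqp hA h0 h1, fun t h => ?_⟩
  rw [hcov, add_sub_cancel_left, ← integral_const_mul, ← integral_const_mul]
  refine integral_congr_ae ?_
  filter_upwards [carfimaDensity_ae_eq (H := H) (σ := σ) (β := β) hqp hA] with w hw
  rw [← hw]
  simp only [expI]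
  push_cast
  ring

end Main

end Carfima

end

noncomputable section

namespace Carfima

open Set

/-! ### Pathwise solution of the state equation. -/

section Pathwise

variable {p : ℕ} (A : Matrix (Fin p) (Fin p) ℝ) (β : Fin p → ℝ)

/-- The kernel `β' exp(A r) v` as a linear function of `v`. -/
def kernelLin (r : ℝ) : (Fin p → ℝ) →ₗ[ℝ] ℝ where
  toFun v := kernel A β v r
  map_add' v w := by rw [kernel, mulVec_add, dotProduct_add]; rfl
  map_smul' c v := by rw [kernel, mulVec_smul, dotProduct_smul]; rfl

theorem continuous_kernel_vec (r : ℝ) : Continuous fun v => kernel A β v r :=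
  (kernelLin A β r).continuous_of_finiteDimensional

theorem kernel_eq_sum (v : Fin p → ℝ) (r : ℝ) :
    kernel A β v r = ∑ i, v i * kernel A β (fun j => if i = j then 1 else 0) r :=
  LinearMap.pi_apply_eq_sum_univ (kernelLin A β r) v

theorem kernel_mulVec_eq_sum (v : Fin p → ℝ) (r : ℝ) :
    kernel A β (A *ᵥ v) r = ∑ i, v i * kernel A β (A *ᵥ fun j => if i = j then 1 else 0) r :=
  LinearMap.pi_apply_eq_sum_univ ((kernelLin A β r).comp (Matrix.mulVecLin A)) v

/-- Linearity of the kernel in its vector reduces this to the scalar product rule in coordinates. -/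
theorem hasDerivAt_kernel_const_sub {y : ℝ → Fin p → ℝ} {y' : Fin p → ℝ} {u : ℝ}
    (hy : HasDerivAt y y' u) (t : ℝ) :
    HasDerivAt (fun u => kernel A β (y u) (t - u))
      (kernel A β y' (t - u) - kernel A β (A *ᵥ y u) (t - u)) u := by
  simp_rw [kernel_mulVec_eq_sum A β (y u), kernel_eq_sum A β (y _), kernel_eq_sum A β y']
  rw [← Finset.sum_sub_distrib]
  refine HasDerivAt.fun_sum fun i _ => ?_
  refine ((hasDerivAt_pi.1 hy i).mul
    (hasDerivAt_comp_const_sub (hasDerivAt_kernel A β _) t u)).congr_deriv ?_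
  ring

variable {x : ℝ → Fin p → ℝ} {c : ℝ → ℝ} {δ : Fin p → ℝ} {a₀ σ : ℝ}

/-- Variation of constants for a path of the state equation. -/
theorem dotProduct_eq_of_state_equation (hx : Continuous x) (hc : Continuous c)
    (h : ∀ s t : ℝ, s ≤ t → x t - x s
      = (∫ u in s..t, (A *ᵥ x u + a₀ • δ)) + (σ * (c t - c s)) • δ) {a t : ℝ} (hat : a ≤ t) :
    β ⬝ᵥ x t = kernel A β (x a) (t - a) + a₀ * (∫ r in (0 : ℝ)..(t - a), kernel A β δ r)
      + σ * byParts c (fun u => kernel A β δ (t - u)) (fun u => -kernel A β (A *ᵥ δ) (t - u)) a t := by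
  set F : ℝ → Fin p → ℝ := fun u => A *ᵥ x u + a₀ • δ with hF
  have hFc : Continuous F := by fun_prop
  -- On [a, t] this is x - σ c δ: removing the rough noise leaves a C¹ path, to which the
  -- fundamental theorem of calculus applies.
  set y : ℝ → Fin p → ℝ := fun u => x a - (σ * c a) • δ + ∫ s in a..u, F s with hy
  have hyd : ∀ u, HasDerivAt y (F u) u := fun u =>
    (intervalIntegral.integral_hasDerivAt_right (hFc.intervalIntegrable _ _)
      (hFc.stronglyMeasurableAtFilter _ _) hFc.continuousAt).const_add _
  have hyx : ∀ u, a ≤ u → y u = x u - (σ * c u) • δ := by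
    intro u hu
    have h1 := h a u hu
    have h2 : x u = x a + (∫ s in a..u, F s) + (σ * (c u - c a)) • δ := by
      rw [add_assoc, ← h1]; abel
    rw [hy, h2]
    simp only
    module
  have hder : ∀ u ∈ uIcc a t, HasDerivAt (fun u => kernel A β (y u) (t - u))
      (σ * (kernel A β (A *ᵥ δ) (t - u) * c u) + a₀ * kernel A β δ (t - u)) u := by
    intro u hu
    rw [uIcc_of_le hat] at hu
    refine (hasDerivAt_kernel_const_sub A β (hyd u) t).congr_deriv ?_
    have h3 : F u = A *ᵥ y u + ((σ * c u) • (A *ᵥ δ) + a₀ • δ) := by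
      rw [hyx u hu.1, mulVec_sub, mulVec_smul, hF]
      simp only
      module
    have h4 : kernel A β (F u) (t - u) = kernelLin A β (t - u) (F u) := rfl
    rw [h4, h3, map_add, map_add, map_smul, map_smul]
    simp only [kernelLin, LinearMap.coe_mk, AddHom.coe_mk, smul_eq_mul]
    ring
  have hkc : ∀ v, Continuous fun u => kernel A β v (t - u) := fun v =>
    (continuous_kernel A β v).comp (by fun_prop)
  have i1 : IntervalIntegrable (fun u => σ * (kernel A β (A *ᵥ δ) (t - u) * c u)) volume a t :=
    (((hkc _).mul hc).const_mul σ).intervalIntegrable _ _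
  have i2 : IntervalIntegrable (fun u => a₀ * kernel A β δ (t - u)) volume a t :=
    ((hkc _).const_mul a₀).intervalIntegrable _ _
  have hftc := intervalIntegral.integral_eq_sub_of_hasDerivAt hder (i1.add i2)
  rw [intervalIntegral.integral_add i1 i2, intervalIntegral.integral_const_mul,
    intervalIntegral.integral_const_mul, hyx a le_rfl, hyx t hat] at hftc
  have hlin : ∀ v e r, kernel A β (v - e • δ) r = kernel A β v r - e * kernel A β δ r := by
    intro v e r
    have h5 : kernel A β (v - e • δ) r = kernelLin A β r (v - e • δ) := rfl
    rw [h5, map_sub, map_smul]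
    rfl
  have hshift := intervalIntegral.integral_comp_sub_left (a := a) (b := t) (kernel A β δ) t
  rw [sub_self] at hshift
  rw [hlin, hlin, sub_self, kernel_zero A β (x t), hshift] at hftc
  simp only [byParts, smul_eq_mul, neg_mul, intervalIntegral.integral_neg, sub_self]
  linarith

/-- A nonzero coordinate of δ lets the noise be solved for in terms of the continuous path x. Path
continuity of `B` is not part of `IsFBM`, so it is recovered here. -/
theorem continuous_of_state_equation (hx : Continuous x) (hσ : σ ≠ 0) (hδ : δ ≠ 0)
    (h : ∀ s t : ℝ, s ≤ t → x t - x s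
      = (∫ u in s..t, (A *ᵥ x u + a₀ • δ)) + (σ * (c t - c s)) • δ) : Continuous c := by
  obtain ⟨i, hi⟩ := Function.ne_iff.1 hδ
  have hFc : Continuous fun u => A *ᵥ x u + a₀ • δ := by fun_prop
  have hall : ∀ t, x t - x 0 - (∫ u in (0 : ℝ)..t, (A *ᵥ x u + a₀ • δ)) = (σ * (c t - c 0)) • δ := by
    intro t
    rcases le_total 0 t with ht | ht
    · rw [h 0 t ht]; abel
    · have h1 := h t 0 ht
      rw [intervalIntegral.integral_symm, ← neg_sub (x 0), h1]
      module
  have hprim : Continuous fun t => ∫ u in (0 : ℝ)..t, (A *ᵥ x u + a₀ • δ) :=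
    intervalIntegral.continuous_primitive (fun _ _ => hFc.intervalIntegrable _ _) 0
  have hceq : c = fun t =>
      c 0 + (x t - x 0 - (∫ u in (0 : ℝ)..t, (A *ᵥ x u + a₀ • δ))) i / (σ * δ i) := by
    ext t
    have hi' : δ i ≠ 0 := hi
    rw [hall, Pi.smul_apply, smul_eq_mul]
    field_simp
    ring
  rw [hceq]
  have h2 : Continuous fun t => (x t - x 0 - (∫ u in (0 : ℝ)..t, (A *ᵥ x u + a₀ • δ))) i :=
    (continuous_apply i).comp ((hx.sub continuous_const).sub hprim)
  fun_prop

end Pathwise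

/-! ### Stationary solutions are moving averages. -/

section Stationary

variable {Ω : Type*} [MeasurableSpace Ω] {P : Measure Ω}

theorem IsStrictlyStationary.identDistrib {E : Type*} [MeasurableSpace E] {X : ℝ → Ω → E}
    (hX : IsStrictlyStationary P X) (s : ℝ) : IdentDistrib (X s) (X 0) P P := by
  have h := (hX {0} s).comp (measurable_pi_apply (⟨0, by simp⟩ : ({0} : Finset ℝ)))
  simpa [Function.comp_def] using h

variable [IsProbabilityMeasure P] {p : ℕ} {X : ℝ → Ω → Fin p → ℝ}

/-- Convergence in measure to 0 depends only on the law of each term, so X_{t-n} may be replaced by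
X_0, for which every path decays. No moments of X are needed. -/
theorem IsStrictlyStationary.tendstoInMeasure_kernel (hX : IsStrictlyStationary P X)
    {A : Matrix (Fin p) (Fin p) ℝ} (hA : IsStable A) (β : Fin p → ℝ) (t : ℝ) :
    TendstoInMeasure P (fun (n : ℕ) ω => kernel A β (X (t - n) ω) n) atTop fun _ => 0 := by
  have h0 : TendstoInMeasure P (fun (n : ℕ) ω => kernel A β (X 0 ω) n) atTop fun _ => 0 := by
    refine tendstoInMeasure_of_tendsto_ae (fun n => ?_) (Eventually.of_forall fun ω => ?_)
    · exact ((continuous_kernel_vec A β n).measurable.comp_aemeasurable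
        (hX.identDistrib 0).aemeasurable_snd).aestronglyMeasurable
    · exact (expDecay_kernel β (X 0 ω) hA).tendsto.comp tendsto_natCast_atTop_atTop
  intro ε hε
  refine (h0 ε hε).congr fun n => ?_
  have hm : MeasurableSet {v : Fin p → ℝ | ε ≤ edist (kernel A β v n) 0} :=
    measurableSet_le measurable_const
      ((continuous_kernel_vec A β n).edist continuous_const).measurable
  exact ((hX.identDistrib (t - n)).measure_mem_eq hm).symm

variable {B : ℝ → Ω → ℝ} {H : ℝ} {q : ℕ} {α β : ℕ → ℝ} {σ : ℝ}

/-- Every strictly stationary solution of the state equation is observed as the CARFIMA moving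
average. -/
theorem IsStateSolution.isMovingAverage (hqp : q < p) (hA : IsStable (companion p α))
    (h0 : 0 < H) (h1 : H < 1) (hσ : 0 < σ) (hB : IsFBM P H B) (hX : IsStateSolution P B p α σ X)
    (hs : IsStrictlyStationary P X) :
    IsMovingAverage P B p q α β σ fun t ω => betaVec p q β ⬝ᵥ X t ω := by
  intro t
  set A := companion p α with hAdef
  set b := betaVec p q β with hbdef
  have hδ : deltaVec p ≠ 0 := by
    intro h
    have := congrFun h ⟨p - 1, by omega⟩
    rw [deltaVec, if_pos (by simp; omega)] at this
    exact one_ne_zero this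
  set g := kernel A b (deltaVec p) with hg
  set k := kernel A b (A *ᵥ deltaVec p) with hk
  have hgd : ∀ r, HasDerivAt g (k r) r := hasDerivAt_kernel A b (deltaVec p)
  have hkc : Continuous k := continuous_kernel _ _ _
  have hgi : IntegrableOn g (Ioi 0) :=
    (expDecay_kernel _ _ hA).integrableOn (continuous_kernel _ _ _)
  refine ⟨_, isMovingAverage_incrementAverage hA h0 h1 hB t, ?_⟩
  set Z : ℝ → Lp ℝ 2 P := fun a =>
    byParts (curveLp P B hB.memLp) (fun u => g (t - u)) (fun u => -k (t - u)) a t with hZ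
  have hpath : ∀ᵐ ω ∂P, Continuous fun t => B t ω := by
    filter_upwards [hX] with ω hω
    exact continuous_of_state_equation A hω.1 hσ.ne' hδ hω.2
  -- Variation of constants from t - n, with everything but the initial term collected into one
  -- element of L².
  have hn : ∀ n : ℕ, ∀ᵐ ω ∂P, b ⬝ᵥ X t ω - kernel A b (X (t - n) ω) n
      = (Lp.constL 2 P ℝ (α 0 * ∫ r in (0 : ℝ)..n, g r) + σ • Z (t - n) : Lp ℝ 2 P) ω := by
    intro n
    have hle : t - n ≤ t := by linarith [(Nat.cast_nonneg n : (0 : ℝ) ≤ n)]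
    filter_upwards [hX, hpath, ae_eq_byParts_of_continuous hB.memLp (hB.continuous_curveLp h0)
        hpath (fun s => hasDerivAt_comp_const_sub hgd t s) (by fun_prop) hle,
      Lp.coeFn_add (Lp.constL 2 P ℝ (α 0 * ∫ r in (0 : ℝ)..n, g r)) (σ • Z (t - n)),
      Lp.coeFn_smul σ (Z (t - n)),
      Lp.coeFn_const (p := 2) (μ := P) (α 0 * ∫ r in (0 : ℝ)..n, g r)] with ω h2 h3 h4 h5 h6 h7
    have h8 := dotProduct_eq_of_state_equation A b h2.1 h3 h2.2 hle
    rw [sub_sub_cancel] at h8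
    have h9 : (Lp.constL 2 P ℝ (α 0 * ∫ r in (0 : ℝ)..n, g r) : Lp ℝ 2 P) ω
        = α 0 * ∫ r in (0 : ℝ)..n, g r := h7
    rw [h5, Pi.add_apply, h9, h6, Pi.smul_apply, h4, h8, smul_eq_mul]
    ring
  have hlimc : Tendsto (fun n : ℕ => ∫ r in (0 : ℝ)..n, g r) atTop (𝓝 (-(1 / α 1))) := by
    rw [← integral_kernel_companion hqp β hA]
    exact intervalIntegral_tendsto_integral_Ioi 0 hgi tendsto_natCast_atTop_atTop
  have hlimZ := (hB.isFractionalCurve.tendsto_byParts h0 h1 hgd hkc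
    (integrableOn_kernel_mul hA _ _) (expDecay_kernel _ _ hA).tendsto_pow_mul t).comp
    (show Tendsto (fun n : ℕ => t - n) atTop atBot by
      simpa only [sub_eq_add_neg, Function.comp_apply] using tendsto_atBot_add_const_left _ t
        (tendsto_neg_atTop_atBot.comp tendsto_natCast_atTop_atTop))
  have hlim := (((Lp.constL 2 P ℝ).continuous.tendsto _).comp (hlimc.const_mul (α 0))).add
    (hlimZ.const_smul σ)
  have hm1 := (tendstoInMeasure_of_tendsto_Lp hlim).congr_left
    fun n => (hn n).mono fun ω hω => hω.symm
  -- The same sequence converges in measure to β'X_t, as its initial term vanishes, and to the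
  -- moving average by `hm1`; the two limits therefore agree.
  have hm2 : TendstoInMeasure P (fun (n : ℕ) ω => b ⬝ᵥ X t ω - kernel A b (X (t - n) ω) n) atTop
      fun ω => b ⬝ᵥ X t ω := by
    intro ε hε
    refine (hs.tendstoInMeasure_kernel hA b t ε hε).congr fun n => ?_
    congr 1
    ext ω
    simp only [mem_ofPred_eq]
    rw [show edist (b ⬝ᵥ X t ω - kernel A b (X (t - n) ω) n) (b ⬝ᵥ X t ω)
      = edist (kernel A b (X (t - n) ω) n) 0 by
        conv_lhs => rw [← sub_zero (b ⬝ᵥ X t ω), sub_sub, zero_add, edist_sub_left]]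
  filter_upwards [tendstoInMeasure_ae_unique hm2 hm1,
    Lp.coeFn_add (Lp.constL 2 P ℝ (α 0 * -(1 / α 1)))
      (σ • (incrementAverage (curveLp P B hB.memLp) k t : Lp ℝ 2 P)),
    Lp.coeFn_smul σ (incrementAverage (curveLp P B hB.memLp) k t : Lp ℝ 2 P),
    Lp.coeFn_const (p := 2) (μ := P) (α 0 * -(1 / α 1))] with ω h2 h3 h4 h5
  have h9 : (Lp.constL 2 P ℝ (α 0 * -(1 / α 1)) : Lp ℝ 2 P) ω = α 0 * -(1 / α 1) := h5
  rw [h2, h3, Pi.add_apply, h9, h4, Pi.smul_apply, smul_eq_mul]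
  ring

end Stationary

end Carfima

end

theorem theorem3 {Ω : Type*} [MeasurableSpace Ω] (P : Measure Ω) [IsProbabilityMeasure P]
    (p q : ℕ) (hqp : q < p) (α β : ℕ → ℝ) (hα : α 1 ≠ 0) (hβ : q ≠ 0 → β q ≠ 0)
    (σ : ℝ) (hσ : 0 < σ) (H : ℝ) (hH0 : 0 < H) (hH1 : H < 1)
    (hA : Carfima.IsStable (Carfima.companion p α))
    (B : ℝ → Ω → ℝ) (hB : Carfima.IsFBM P H B) :
    (∃ Y : ℝ → Ω → ℝ, Carfima.IsMovingAverage P B p q α β σ Y) ∧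
    (∀ Y : ℝ → Ω → ℝ, Carfima.IsMovingAverage P B p q α β σ Y →
      Carfima.HasSpectralDensity P Y (Carfima.carfimaDensity p q α β H σ)) ∧
    (∀ X : ℝ → Ω → Fin p → ℝ, Carfima.IsStateSolution P B p α σ X →
      Carfima.IsStrictlyStationary P X →
      Carfima.HasSpectralDensity P (fun t ω => Carfima.betaVec p q β ⬝ᵥ X t ω)
        (Carfima.carfimaDensity p q α β H σ)) ∧
    (∀ w : ℝ, Carfima.carfimaDensity p q α β H σ w =
      Carfima.armaDensity p q α β σ w *
        (Real.Gamma (2 * H + 1) * Real.sin (Real.pi * H) * |w| ^ (1 - 2 * H))) ∧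
    (H < 1 / 2 → Carfima.carfimaDensity p q α β H σ 0 = 0) := by
  -- The process is left to unification: `rfl` makes it -α_0/α_1 + σ times `incrementAverage`.
  refine ⟨⟨_, fun t => ⟨_, Carfima.isMovingAverage_incrementAverage hA hH0 hH1 hB t,
    Eventually.of_forall fun ω => rfl⟩⟩, fun Y hY => hY.hasSpectralDensity hqp hA hH0 hH1 hB,
    fun X hX hs => (hX.isMovingAverage hqp hA hH0 hH1 hσ hB hs).hasSpectralDensity
      hqp hA hH0 hH1 hB, fun w => ?_, fun hH => ?_⟩
  -- The case w = 0, H > 1/2 is included, since both sides use the same value 0 for the negative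
  -- power of 0.
  · rw [Carfima.carfimaDensity, Carfima.armaDensity]
    ring
  · rw [Carfima.carfimaDensity, abs_zero, Real.zero_rpow (by linarith)]
    simp
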